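/- Let $a\le b$ be real numbers, let $I=[a,b]$, and let $f:I\to I$ be a continuous map with zero topological entropy. Write $f^n$ for the $n$-th iterate of $f$ and $\mathbb N=\{1,2,3,\dots\}$. A nonempty closed set $K\subseteq I$ is called *minimal* if $f(K)\subseteq K$ and $\overline{\{f^n x : n\in\mathbb N\}}=K$ for every $x\in K$. For $E\subseteq\mathbb N$ the upper density is $\overline D(E)=\limsup_{N\to\infty}\frac{\#(E\cap[1,N])}{N}$. Then both of the following hold. 1. The flow generated by $f$ is minimally mean-attractable: for every $x\in I$ there is a minimal set $K\subseteq I$ such that for every $\varepsilon>0$ there is a point $z\in K$ with $$\limsup_{N\to\infty}\frac1N\sum_{n=1}^N |f^n x-f^n z|<\varepsilon .$$ 2. The flow generated by $f$ is minimally mean-L-stable: for every minimal set $K\subseteq I$ and every $\varepsilon>0$ there is $\delta>0$ such that for all $x,y\in K$ with $|x-y|<\delta$ there is a set $E\subseteq\mathbb N$ with $\overline D(E)<\varepsilon$ and $|f^n x-f^n y|<\varepsilon$ for all $n\in\mathbb N\setminus E$. -/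

import Mathlib

namespace MeanDynamics

open Filter

/-- The upper density `limsup_{N → ∞} #(E ∩ [1, N]) / N` of a set of natural numbers. The quotients
lie in `[0, 1]`, so this is a genuine limsup of a bounded real sequence. -/
noncomputable def upperDensity (E : Set ℕ) : ℝ :=
  limsup (fun N : ℕ => ((E ∩ Set.Icc 1 N).ncard : ℝ) / (N : ℝ)) atTop

/-- The flow generated by `f` is mean-L-stable: for every `ε > 0` there is `δ > 0` such that
`d(x, y) < δ` implies `d(f^n x, f^n y) < ε` for all `n ≥ 1` outside a set of upper density
less than `ε`. -/
def MeanLStable {X : Type*} [MetricSpace X] (f : X → X) : Prop :=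
  ∀ ε : ℝ, 0 < ε → ∃ δ : ℝ, 0 < δ ∧ ∀ x y : X, dist x y < δ →
    ∃ E : Set ℕ, upperDensity E < ε ∧
      ∀ n : ℕ, 1 ≤ n → n ∉ E → dist (f^[n] x) (f^[n] y) < ε

/-- `K` is a minimal set of `f`: a nonempty closed set with `f(K) ⊆ K` in which every point has
a forward orbit `{f^n x | n ≥ 1}` with closure `K`. -/
structure IsMinimalSet {X : Type*} [MetricSpace X] (f : X → X) (K : Set X) : Prop where
  isClosed : IsClosed K
  nonempty : K.Nonempty
  mapsTo : Set.MapsTo f K K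
  closure_orbit : ∀ x ∈ K, closure {y : X | ∃ n : ℕ, 1 ≤ n ∧ f^[n] x = y} = K

/-- The flow generated by `f` is minimally mean-L-stable: the restriction `f|K : K → K` to every
minimal set `K` is mean-L-stable. -/
def MinimallyMeanLStable {X : Type*} [MetricSpace X] (f : X → X) : Prop :=
  ∀ (K : Set X) (hK : IsMinimalSet f K), MeanLStable (hK.mapsTo.restrict f K K)

/-- `x` is mean-attracted to `K`: for every `ε > 0` there is `z ∈ K` such that
`limsup_{N → ∞} (1/N) ∑_{n=1}^N d(f^n x, f^n z) < ε`. In a compact space the averages are bounded,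
so this is a genuine limsup of a bounded real sequence. -/
def MeanAttracted {X : Type*} [MetricSpace X] [CompactSpace X] (f : X → X) (K : Set X) (x : X) :
    Prop :=
  ∀ ε : ℝ, 0 < ε → ∃ z ∈ K,
    limsup (fun N : ℕ => (1 / (N : ℝ)) * ∑ n ∈ Finset.Icc 1 N, dist (f^[n] x) (f^[n] z)) atTop < ε

/-- The basin of mean-attraction of `K`. -/
def basin {X : Type*} [MetricSpace X] [CompactSpace X] (f : X → X) (K : Set X) : Set X :=
  {x | MeanAttracted f K x}

/-- The flow generated by `f` is minimally mean-attractable: the space is the union of the basins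
of mean-attraction of the minimal sets. -/
def MinimallyMeanAttractable {X : Type*} [MetricSpace X] [CompactSpace X] (f : X → X) : Prop :=
  Set.univ = ⋃ (K : Set X) (_ : IsMinimalSet f K), basin f K

end MeanDynamics

/-! Zero entropy excludes horseshoes. If an iterate of `f` were turbulent, twice that iterate would
have two disjoint intervals each covering both, so itineraries could be prescribed freely and the
entropy would be at least a positive multiple of `log 2` (`coverEntropy_pos_of_horseshoe`). Hence
the extension of `f` to the line, constant outside `[a, b]`, is tame.

For a tame map an infinite `ω`-limit set `W` has a rigid structure. In the absence of turbulence the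
right-moving points of an orbit lie to the left of the left-moving ones (`up_lt_down`). This forces
an `ω`-limit set containing a fixed point to be finite (`omegaSet_finite_of_fixed`), so an infinite
`W` contains no periodic point, and `f` then swaps two halves of `W` lying on either side of a point
(`exists_swap_point`). Repeating the argument for `f^2, f^4, ...` splits `W` into `2 ^ k` cyclically
permuted parts with disjoint convex hulls (`separated_omegaSet_two_pow`).

The hulls are disjoint subintervals of `[a, b]`, so the diameters of the parts add up to at most `b
- a` and average at most `(b - a) / 2 ^ k`. Two points of one part travel through the same parts, so
their mean distance is small and they are rarely far apart. This gives mean-L-stability on a minimal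
set, which is the `ω`-limit set of each of its points. It also gives mean-attraction, since an orbit
approaches the parts it visits. Finite `ω`-limit sets are discrete, and an orbit tracks their points
step by step. -/

namespace MeanDynamics

open Filter Set Topology

/-! ### Turbulence and reflection -/

/-- `f` is turbulent: two compact intervals with a common endpoint both cover their union. -/
def Turbulent (f : ℝ → ℝ) : Prop :=
  ∃ s t u, s < t ∧ t < u ∧ Icc s u ⊆ f '' Icc s t ∧ Icc s u ⊆ f '' Icc t u

/-- No iterate of `f` is turbulent. -/
def Tame (f : ℝ → ℝ) : Prop := ∀ n : ℕ, ¬ Turbulent f^[n]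

theorem Tame.iterate {f : ℝ → ℝ} (hf : Tame f) (m : ℕ) : Tame f^[m] := fun n => by
  rw [← Function.iterate_mul]; exact hf _

theorem Tame.not_turbulent {f : ℝ → ℝ} (hf : Tame f) : ¬ Turbulent f := hf 1

theorem not_turbulent_id : ¬ Turbulent id := by
  rintro ⟨s, t, u, h1, h2, h3, -⟩
  rw [image_id] at h3
  have := (h3 ⟨(h1.trans h2).le, le_rfl⟩).2
  linarith

/-- Continuous functions cover every interval between two of their values. -/
theorem Icc_subset_image {f : ℝ → ℝ} (hf : Continuous f) {c d x y s u : ℝ} (hx : x ∈ Icc c d)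
    (hy : y ∈ Icc c d) (hs : f x ≤ s) (hu : u ≤ f y) : Icc s u ⊆ f '' Icc c d := fun _ ht =>
  (isPreconnected_Icc.image f hf.continuousOn).Icc_subset (mem_image_of_mem f hx)
    (mem_image_of_mem f hy) ⟨hs.trans ht.1, ht.2.trans hu⟩

theorem turbulent_of_left {f : ℝ → ℝ} (hf : Continuous f) {s t u : ℝ} (h1 : s < t) (h2 : t < u)
    (hs : f s ≤ s) (ht : u ≤ f t) (hu : f u ≤ s) : Turbulent f :=
  ⟨s, t, u, h1, h2,
    Icc_subset_image hf (left_mem_Icc.2 h1.le) (right_mem_Icc.2 h1.le) hs ht,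
    Icc_subset_image hf (right_mem_Icc.2 h2.le) (left_mem_Icc.2 h2.le) hu ht⟩

theorem turbulent_of_right {f : ℝ → ℝ} (hf : Continuous f) {s t u : ℝ} (h1 : s < t) (h2 : t < u)
    (hs : u ≤ f s) (ht : f t ≤ s) (hu : u ≤ f u) : Turbulent f :=
  ⟨s, t, u, h1, h2,
    Icc_subset_image hf (right_mem_Icc.2 h1.le) (left_mem_Icc.2 h1.le) ht hs,
    Icc_subset_image hf (left_mem_Icc.2 h2.le) (right_mem_Icc.2 h2.le) ht hu⟩

/-- The conjugate of `f` by the reflection `t ↦ -t`. -/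
def reflect (f : ℝ → ℝ) : ℝ → ℝ := fun t => -f (-t)

theorem reflect_iterate (f : ℝ → ℝ) (n : ℕ) : (reflect f)^[n] = reflect f^[n] := by
  funext t
  induction n with
  | zero => simp [reflect]
  | succ n ih => rw [Function.iterate_succ_apply', ih]; simp [reflect, Function.iterate_succ_apply']

theorem reflect_reflect (f : ℝ → ℝ) : reflect (reflect f) = f := by
  funext t; simp [reflect]

theorem continuous_reflect {f : ℝ → ℝ} (hf : Continuous f) : Continuous (reflect f) :=
  (hf.comp continuous_neg).neg

theorem Turbulent.reflect {f : ℝ → ℝ} (h : Turbulent f) : Turbulent (reflect f) := by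
  obtain ⟨s, t, u, h1, h2, h3, h4⟩ := h
  refine ⟨-u, -t, -s, by linarith, by linarith, ?_, ?_⟩
  · rintro z ⟨hz1, hz2⟩
    obtain ⟨y, hy, hyz⟩ := h4 (show -z ∈ Icc s u from ⟨by linarith, by linarith⟩)
    exact ⟨-y, ⟨by linarith [hy.2], by linarith [hy.1]⟩, by simp [MeanDynamics.reflect, hyz]⟩
  · rintro z ⟨hz1, hz2⟩
    obtain ⟨y, hy, hyz⟩ := h3 (show -z ∈ Icc s u from ⟨by linarith, by linarith⟩)
    exact ⟨-y, ⟨by linarith [hy.2], by linarith [hy.1]⟩, by simp [MeanDynamics.reflect, hyz]⟩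

theorem not_turbulent_reflect {f : ℝ → ℝ} (h : ¬ Turbulent f) : ¬ Turbulent (reflect f) :=
  fun h' => h (by simpa [reflect_reflect] using h'.reflect)

theorem Tame.reflect {f : ℝ → ℝ} (h : Tame f) : Tame (reflect f) := fun n => by
  rw [reflect_iterate]; exact not_turbulent_reflect (h n)

/-! ### Horseshoes and positive entropy -/

/-- A turbulent map has a second iterate with two disjoint intervals covering each other. -/
theorem Turbulent.exists_horseshoe {g : ℝ → ℝ} (hg : Continuous g) (h : Turbulent g) :
    ∃ s c d t u : ℝ, s ≤ c ∧ c < d ∧ d < t ∧ t < u ∧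
      Icc s u ⊆ g^[2] '' Icc c d ∧ Icc s u ⊆ g^[2] '' Icc t u := by
  obtain ⟨s, t, u, h1, h2, h3, h4⟩ := h
  have hsu : s ≤ u := (h1.trans h2).le
  have key : ∀ c d, Icc s t ⊆ g '' Icc c d ∨ Icc t u ⊆ g '' Icc c d →
      Icc s u ⊆ g^[2] '' Icc c d := by
    intro c d hcd
    rw [show g^[2] = g ∘ g from rfl, image_comp]
    rcases hcd with hcd | hcd
    · exact h3.trans (image_mono hcd)
    · exact h4.trans (image_mono hcd)
  have hB : Icc s u ⊆ g^[2] '' Icc t u := key _ _ (Or.inr ((Icc_subset_Icc_left h1.le).trans h4))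
  -- The two intervals share `t`, so `[s, t]` must be shrunk away from it. Between preimages `α` of
  -- `s` and `β` of `u` there is a preimage `γ` of `t`. The piece from the left one of `α`, `β` to
  -- `γ` stops short of `t` and still covers `[s, t]` or `[t, u]`, which a second application of `g`
  -- spreads over `[s, u]`.
  obtain ⟨α, hα, hαs⟩ := h3 (left_mem_Icc.2 hsu)
  obtain ⟨β, hβ, hβu⟩ := h3 (right_mem_Icc.2 hsu)
  rcases lt_trichotomy α β with hlt | heq | hlt
  · obtain ⟨γ, hγ, hγt⟩ := intermediate_value_Icc hlt.le hg.continuousOn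
      (show t ∈ Icc (g α) (g β) by rw [hαs, hβu]; exact ⟨h1.le, h2.le⟩)
    have h5 : α < γ := lt_of_le_of_ne hγ.1 (by rintro rfl; linarith)
    have h6 : γ < β := lt_of_le_of_ne hγ.2 (by rintro rfl; linarith)
    exact ⟨s, α, γ, t, u, hα.1, h5, h6.trans_le hβ.2, h2, key _ _ (Or.inl
      (Icc_subset_image hg (left_mem_Icc.2 h5.le) (right_mem_Icc.2 h5.le) hαs.le hγt.ge)), hB⟩
  · subst heq; linarith
  · obtain ⟨γ, hγ, hγt⟩ := intermediate_value_Icc' hlt.le hg.continuousOn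
      (show t ∈ Icc (g α) (g β) by rw [hαs, hβu]; exact ⟨h1.le, h2.le⟩)
    have h5 : β < γ := lt_of_le_of_ne hγ.1 (by rintro rfl; linarith)
    have h6 : γ < α := lt_of_le_of_ne hγ.2 (by rintro rfl; linarith)
    exact ⟨s, β, γ, t, u, hβ.1, h5, h6.trans_le hα.2, h2, key _ _ (Or.inr
      (Icc_subset_image hg (right_mem_Icc.2 h5.le) (left_mem_Icc.2 h5.le) hγt.le hβu.ge)), hB⟩

/-- In a horseshoe every itinerary of finite length is realised. -/
theorem exists_itinerary {X : Type*} {h : X → X} {A B : Set X} (hne : (A ∪ B).Nonempty)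
    (hA : A ∪ B ⊆ h '' A) (hB : A ∪ B ⊆ h '' B) (k : ℕ) (w : ℕ → Bool) :
    ∃ z ∈ A ∪ B, ∀ i < k, h^[i] z ∈ if w i then A else B := by
  induction k generalizing w with
  | zero => obtain ⟨z, hz⟩ := hne; exact ⟨z, hz, by simp⟩
  | succ k ih =>
    obtain ⟨z', hz', hw'⟩ := ih fun i => w (i + 1)
    have : ∃ z ∈ (if w 0 then A else B), h z = z' := by
      split_ifs
      · exact hA hz'
      · exact hB hz'
    obtain ⟨z, hz, rfl⟩ := this
    refine ⟨z, ?_, ?_⟩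
    · split_ifs at hz
      · exact Or.inl hz
      · exact Or.inr hz
    · rintro (_ | i) hi
      · exact hz
      · exact hw' i (by omega)

/-- Points with different itineraries of length `k` are `δ` apart at some time below `N * k`, so
their dynamical balls of radius `δ / 2` are disjoint. This yields nets of `2 ^ k` points, a growth
rate of at least `log 2 / N`. -/
theorem coverEntropy_pos_of_horseshoe {X : Type*} [PseudoMetricSpace X] {f : X → X} {N : ℕ}
    (hN : 0 < N) {A B : Set X} {δ : ℝ} (hδ : 0 < δ) (hAB : ∀ x ∈ A, ∀ y ∈ B, δ ≤ dist x y)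
    (hne : (A ∪ B).Nonempty) (hA : A ∪ B ⊆ f^[N] '' A) (hB : A ∪ B ⊆ f^[N] '' B) :
    0 < Dynamics.coverEntropy f univ := by
  classical
  set U : SetRel X X := {p | dist p.1 p.2 < δ / 2}
  have hU : U ∈ uniformity X := Metric.dist_mem_uniformity (by positivity)
  have hcard : ∀ k : ℕ, ((2 ^ k : ℕ) : ℕ∞) ≤ Dynamics.netMaxcard f univ U (N * k) := by
    intro k
    choose z hz hzw using exists_itinerary hne hA hB k
    let e : (Fin k → Bool) → ℕ → Bool := fun w i => if hi : i < k then w ⟨i, hi⟩ else true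
    have hsep : ∀ w w' : Fin k → Bool, w ≠ w' → ∃ i < N * k,
        δ ≤ dist (f^[i] (z (e w))) (f^[i] (z (e w'))) := by
      intro w w' hww
      obtain ⟨i, hi⟩ := Function.ne_iff.1 hww
      refine ⟨N * i, (Nat.mul_lt_mul_left hN).2 i.2, ?_⟩
      have h1 := hzw (e w) i i.2
      have h2 := hzw (e w') i i.2
      rw [← Function.iterate_mul] at h1 h2
      simp only [e, i.2, dif_pos, Fin.eta] at h1 h2
      cases hw : w i <;> cases hw' : w' i <;> simp_all
      · rw [dist_comm]; exact hAB _ h2 _ h1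
      · exact hAB _ h1 _ h2
    have hinj : Function.Injective fun w => z (e w) := by
      intro w w' hww
      by_contra hne
      obtain ⟨i, -, hi⟩ := hsep w w' hne
      simp only at hww
      rw [hww, dist_self] at hi
      linarith
    have hnet : Dynamics.IsDynNetIn f univ U (N * k)
        (Finset.univ.image fun w => z (e w) : Finset X) := by
      refine ⟨subset_univ _, ?_⟩
      intro x hx y hy hxy
      simp only [Finset.coe_image, Finset.coe_univ, image_univ, mem_range] at hx hy
      obtain ⟨w, rfl⟩ := hx
      obtain ⟨w', rfl⟩ := hy
      obtain ⟨i, hi, hid⟩ := hsep w w' (by rintro rfl; exact hxy rfl)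
      refine Set.disjoint_left.2 fun p hp hp' => ?_
      rw [Dynamics.mem_ball_dynEntourage] at hp hp'
      have h1 : dist (f^[i] (z (e w))) (f^[i] p) < δ / 2 := hp i hi
      have h2 : dist (f^[i] (z (e w'))) (f^[i] p) < δ / 2 := hp' i hi
      linarith [dist_triangle_right (f^[i] (z (e w))) (f^[i] (z (e w'))) (f^[i] p)]
    have := hnet.card_le_netMaxcard
    rwa [Finset.card_image_of_injective _ hinj, Finset.card_univ, Fintype.card_fun,
      Fintype.card_bool, Fintype.card_fin] at this
  have hNR : (0 : ℝ) < N := by exact_mod_cast hN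
  have hle : ((Real.log 2 / N : ℝ) : EReal) ≤ Dynamics.netEntropyEntourage f univ U := by
    refine Frequently.le_expGrowthSup ?_
    rw [frequently_atTop]
    intro n
    refine ⟨N * n, Nat.le_mul_of_pos_left n hN, ?_⟩
    have h1 : ((Real.log 2 / N : ℝ) : EReal) * ((N * n : ℕ) : EReal)
        = ((Real.log 2 * n : ℝ) : EReal) := by
      rw [← EReal.coe_natCast, ← EReal.coe_mul]
      congr 1; push_cast; field_simp
    have h2 : EReal.exp ((Real.log 2 * n : ℝ) : EReal) = ((2 ^ n : ℕ) : ENNReal) := by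
      rw [EReal.exp_coe, mul_comm, Real.exp_nat_mul, Real.exp_log two_pos,
        ENNReal.ofReal_pow two_pos.le]
      simp
    rw [h1, h2]
    have := ENat.toENNReal_mono (hcard n)
    simpa using this
  refine lt_of_lt_of_le ?_ (hle.trans (Dynamics.netEntropyEntourage_le_coverEntropy f univ hU))
  exact_mod_cast div_pos (Real.log_pos one_lt_two) hNR

theorem IccExtend_iterate {a b : ℝ} (hab : a ≤ b) (f : Icc a b → Icc a b) (n : ℕ) (x : Icc a b) :
    (IccExtend hab fun t => (f t : ℝ))^[n] x = f^[n] x := by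
  induction n with
  | zero => rfl
  | succ n ih => rw [Function.iterate_succ_apply', ih, IccExtend_val, Function.iterate_succ_apply']

theorem tame_IccExtend {a b : ℝ} (hab : a ≤ b) {f : Icc a b → Icc a b} (hf : Continuous f)
    (hent : Dynamics.coverEntropy f univ = 0) : Tame (IccExtend hab fun t => (f t : ℝ)) := by
  set F := IccExtend hab fun t => (f t : ℝ) with hF
  have hFc : Continuous F := (continuous_subtype_val.comp hf).Icc_extend'
  have hFr : ∀ t, F t ∈ Icc a b := fun t => (f _).2
  intro n hn
  rcases Nat.eq_zero_or_pos n with rfl | hpos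
  · exact not_turbulent_id hn
  obtain ⟨s, c, d, t, u, h1, h2, h3, h4, hA, hB⟩ := hn.exists_horseshoe (hFc.iterate n)
  rw [← Function.iterate_mul] at hA hB
  have hN : 0 < n * 2 := by omega
  have hr : Icc s u ⊆ Icc a b := by
    refine hA.trans ?_
    rintro _ ⟨y, -, rfl⟩
    obtain ⟨k, hk⟩ : ∃ k, n * 2 = k + 1 := ⟨n * 2 - 1, by omega⟩
    rw [hk, Function.iterate_succ_apply']
    exact hFr _
  let A : Set (Icc a b) := Subtype.val ⁻¹' Icc c d
  let B : Set (Icc a b) := Subtype.val ⁻¹' Icc t u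
  have hsub : ∀ p : Icc a b, p ∈ A ∪ B → (p : ℝ) ∈ Icc s u := by
    rintro p (hp | hp)
    · exact ⟨h1.trans hp.1, by linarith [hp.2]⟩
    · exact ⟨by linarith [hp.1], hp.2⟩
  have hlift : ∀ c d, Icc c d ⊆ Icc s u → Icc s u ⊆ F^[n * 2] '' Icc c d →
      A ∪ B ⊆ f^[n * 2] '' (Subtype.val ⁻¹' Icc c d) := by
    intro c d hcd hcov p hp
    obtain ⟨y, hy, hyp⟩ := hcov (hsub p hp)
    refine ⟨⟨y, hr (hcd hy)⟩, hy, Subtype.ext ?_⟩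
    rw [← hyp, ← IccExtend_iterate hab]
  refine hent.not_gt (coverEntropy_pos_of_horseshoe hN (sub_pos.2 h3) (A := A) (B := B) ?_ ?_
    (hlift c d (Icc_subset_Icc h1 (by linarith)) hA) (hlift t u (Icc_subset_Icc (by linarith) le_rfl) hB))
  · intro x hx y hy
    rw [Subtype.dist_eq, dist_comm, Real.dist_eq]
    exact le_trans (by linarith [hx.2, hy.1]) (le_abs_self _)
  · exact ⟨⟨c, hr ⟨h1, by linarith⟩⟩, Or.inl ⟨le_rfl, h2.le⟩⟩

/-! ### Limit sets of a map and of its iterates -/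

/-- The `ω`-limit set of `x` under `f`. -/
def omegaSet (f : ℝ → ℝ) (x : ℝ) : Set ℝ := {y | MapClusterPt y atTop fun n => f^[n] x}

section omegaSet

variable {f : ℝ → ℝ} {x : ℝ}

theorem exists_ge_of_mem_omegaSet {y : ℝ} (hy : y ∈ omegaSet f x) {p : ℝ → Prop}
    (hp : ∀ᶠ t in 𝓝 y, p t) (N : ℕ) : ∃ n ≥ N, p (f^[n] x) :=
  frequently_atTop.1 (MapClusterPt.frequently hy hp) N

theorem isClosed_omegaSet : IsClosed (omegaSet f x) := by
  have : omegaSet f x = {y | ClusterPt y (map (fun n => f^[n] x) atTop)} := rfl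
  rw [this]
  exact isClosed_setOfPred_clusterPt

theorem omegaSet_subset {S : Set ℝ} (hS : IsClosed S) (h : ∀ᶠ n in atTop, f^[n] x ∈ S) :
    omegaSet f x ⊆ S := fun _ hy => hS.mem_of_mapClusterPt hy h

theorem omegaSet_apply : omegaSet f (f x) = omegaSet f x := by
  ext y
  have h : (fun n => f^[n] (f x)) = (fun n => f^[n] x) ∘ fun n => n + 1 := by
    funext n; simp [Function.iterate_succ_apply]
  change MapClusterPt y atTop _ ↔ MapClusterPt y atTop _
  rw [h, MapClusterPt, MapClusterPt, ← map_map, map_add_atTop_eq_nat]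

theorem omegaSet_iterate_apply (k : ℕ) : omegaSet f (f^[k] x) = omegaSet f x := by
  induction k with
  | zero => rfl
  | succ k ih => rw [Function.iterate_succ_apply', omegaSet_apply, ih]

theorem iterate_mul_add (m k i : ℕ) : (f^[m])^[k] (f^[i] x) = f^[m * k + i] x := by
  rw [← Function.iterate_mul, ← Function.iterate_add_apply]

theorem omegaSet_iterate_congr {m i j : ℕ} (h : i ≡ j [MOD m]) :
    omegaSet f^[m] (f^[i] x) = omegaSet f^[m] (f^[j] x) := by
  wlog hij : i ≤ j generalizing i j
  · exact (this h.symm (not_le.1 hij).le).symm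
  obtain ⟨k, hk⟩ := (Nat.modEq_iff_dvd' hij).1 h
  have : j = m * k + i := by omega
  rw [this, ← iterate_mul_add, omegaSet_iterate_apply]

theorem omegaSet_iterate_subset {m : ℕ} (hm : 0 < m) (i : ℕ) :
    omegaSet f^[m] (f^[i] x) ⊆ omegaSet f x := by
  intro y hy
  have ht : Tendsto (fun k => m * k + i) atTop atTop :=
    tendsto_atTop_mono (fun k => (Nat.le_mul_of_pos_left k hm).trans (Nat.le_add_right _ _))
      tendsto_id
  refine MapClusterPt.of_comp (u := fun n => f^[n] x) ht ?_
  have : (fun n => f^[n] x) ∘ (fun k => m * k + i) = fun k => (f^[m])^[k] (f^[i] x) := by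
    funext k; simp [iterate_mul_add]
  rw [this]
  exact hy

/-- Pigeonhole over residues: if each of the `m` subsequences eventually avoided a neighbourhood of
`y`, the whole orbit would avoid their intersection. -/
theorem exists_mem_omegaSet_iterate {m : ℕ} (hm : 0 < m) {y : ℝ} (hy : y ∈ omegaSet f x) :
    ∃ i < m, y ∈ omegaSet f^[m] (f^[i] x) := by
  by_contra! h
  have h' : ∀ i, i < m → ∃ s ∈ 𝓝 y, ∃ N, ∀ k ≥ N, (f^[m])^[k] (f^[i] x) ∉ s := by
    intro i hi
    have := h i hi
    change ¬ MapClusterPt _ _ _ at this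
    rw [mapClusterPt_iff_frequently] at this
    push Not at this
    obtain ⟨s, hs, hs'⟩ := this
    exact ⟨s, hs, eventually_atTop.1 hs'⟩
  choose! s hs N hN using h'
  have hS : ∀ᶠ t in 𝓝 y, ∀ i ∈ Finset.range m, t ∈ s i := by
    rw [Filter.eventually_all_finset]
    exact fun i hi => hs i (Finset.mem_range.1 hi)
  obtain ⟨n, hn, hns⟩ := exists_ge_of_mem_omegaSet hy hS (m * (∑ i ∈ Finset.range m, N i + 1))
  have hi : n % m < m := Nat.mod_lt _ hm
  refine hN (n % m) hi (n / m) ?_ ?_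
  · have h1 : N (n % m) ≤ ∑ i ∈ Finset.range m, N i :=
      Finset.single_le_sum (f := N) (fun _ _ => Nat.zero_le _) (Finset.mem_range.2 hi)
    have h2 : ∑ i ∈ Finset.range m, N i + 1 ≤ n / m := by
      rw [Nat.le_div_iff_mul_le hm, mul_comm]; exact hn
    omega
  · rw [iterate_mul_add, Nat.div_add_mod]
    exact hns _ (Finset.mem_range.2 hi)

theorem map_mem_omegaSet_iterate (hf : Continuous f) {m : ℕ} {y : ℝ} (j : ℕ)
    (hy : y ∈ omegaSet f^[m] x) : f^[j] y ∈ omegaSet f^[m] (f^[j] x) := by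
  have := MapClusterPt.continuousAt_comp ((hf.iterate j).continuousAt (x := y)) hy
  change MapClusterPt _ _ _
  convert this using 1
  funext k
  simp only [Function.comp_apply, ← Function.iterate_mul, ← Function.iterate_add_apply, add_comm]

theorem map_mem_omegaSet (hf : Continuous f) {y : ℝ} (j : ℕ) (hy : y ∈ omegaSet f x) :
    f^[j] y ∈ omegaSet f x := by
  have := map_mem_omegaSet_iterate (m := 1) hf j hy
  rwa [Function.iterate_one, omegaSet_iterate_apply] at this

theorem omegaSet_subset_of_tendsto {L : ℝ} (h : Tendsto (fun n => f^[n] x) atTop (𝓝 L)) :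
    omegaSet f x ⊆ {L} := fun y hy => by
  by_contra hne
  obtain ⟨u, v, hu, hv, huL, hvy, hd⟩ := t2_separation (Ne.symm hne : L ≠ y)
  obtain ⟨N, hN⟩ := eventually_atTop.1 (h.eventually (hu.mem_nhds huL))
  obtain ⟨n, hn, hnv⟩ := exists_ge_of_mem_omegaSet hy (hv.mem_nhds hvy) N
  exact disjoint_left.1 hd (hN n hn) hnv

theorem omegaSet_finite_of_iterate_eq {n m : ℕ} (hm : 0 < m) (h : f^[n + m] x = f^[n] x) :
    (omegaSet f x).Finite := by
  have hmem : ∀ k, f^[k] x ∈ (fun i => f^[i] x) '' Iio (n + m) := by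
    intro k
    induction k using Nat.strong_induction_on with
    | _ k ih =>
      rcases lt_or_ge k (n + m) with hk | hk
      · exact ⟨k, hk, rfl⟩
      · have : f^[k] x = f^[k - m] x := by
          rw [show k = (k - (n + m)) + (n + m) by omega, Function.iterate_add_apply, h,
            ← Function.iterate_add_apply]
          congr 2; omega
        rw [this]
        exact ih _ (by omega)
  have hfin : ((fun i => f^[i] x) '' Iio (n + m)).Finite := (finite_Iio _).image _
  exact hfin.subset (omegaSet_subset hfin.isClosed (Eventually.of_forall hmem))

theorem mem_omegaSet_reflect {y : ℝ} : y ∈ omegaSet (reflect f) (-x) ↔ -y ∈ omegaSet f x := by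
  have key : ∀ (f : ℝ → ℝ) (x y : ℝ), y ∈ omegaSet f x → -y ∈ omegaSet (reflect f) (-x) := by
    intro f x y hy
    have := MapClusterPt.continuousAt_comp (continuous_neg.continuousAt (x := y)) hy
    change MapClusterPt _ _ _
    convert this using 1
    funext k
    simp [reflect_iterate, reflect]
  refine ⟨fun h => ?_, fun h => ?_⟩
  · simpa [reflect_reflect] using key _ _ _ h
  · simpa using key _ _ _ h

variable {a b : ℝ}

theorem iterate_mem_Icc (hr : ∀ t, f t ∈ Icc a b) {n : ℕ} (hn : 0 < n) (t : ℝ) :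
    f^[n] t ∈ Icc a b := by
  obtain ⟨k, rfl⟩ : ∃ k, n = k + 1 := ⟨n - 1, by omega⟩
  rw [Function.iterate_succ_apply']
  exact hr _

theorem omegaSet_subset_Icc (hr : ∀ t, f t ∈ Icc a b) : omegaSet f x ⊆ Icc a b :=
  omegaSet_subset isClosed_Icc ((eventually_gt_atTop 0).mono fun _ hn => iterate_mem_Icc hr hn x)

theorem isCompact_omegaSet (hr : ∀ t, f t ∈ Icc a b) : IsCompact (omegaSet f x) :=
  isCompact_Icc.of_isClosed_subset isClosed_omegaSet (omegaSet_subset_Icc hr)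

theorem eventually_mem_of_omegaSet_subset (hr : ∀ t, f t ∈ Icc a b) {O : Set ℝ} (hO : IsOpen O)
    (h : omegaSet f x ⊆ O) : ∀ᶠ n in atTop, f^[n] x ∈ O := by
  by_contra hcon
  rw [not_eventually] at hcon
  have hfr : ∃ᶠ n in atTop, f^[n] x ∈ Icc a b ∩ Oᶜ :=
    (hcon.and_eventually ((eventually_gt_atTop 0).mono
      fun _ hn => iterate_mem_Icc hr hn x)).mono fun n hn => ⟨hn.2, hn.1⟩
  obtain ⟨y, hy, hyc⟩ := (isCompact_Icc.inter_right hO.isClosed_compl).exists_mapClusterPt_of_frequently hfr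
  exact hy.2 (h hyc)

theorem omegaSet_nonempty (hr : ∀ t, f t ∈ Icc a b) : (omegaSet f x).Nonempty := by
  by_contra h
  rw [not_nonempty_iff_eq_empty] at h
  obtain ⟨n, hn⟩ := (eventually_mem_of_omegaSet_subset hr isOpen_empty h.subset).exists
  exact hn

theorem exists_preimage_omegaSet_iterate (hf : Continuous f) (hr : ∀ t, f t ∈ Icc a b) {m : ℕ}
    (hm : 0 < m) {y : ℝ} (hy : y ∈ omegaSet f^[m] (f x)) : ∃ z ∈ omegaSet f^[m] x, f z = y := by
  by_contra! h
  have hr' : ∀ t, f^[m] t ∈ Icc a b := iterate_mem_Icc hr hm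
  have hcl : IsCompact (f '' omegaSet f^[m] x) := (isCompact_omegaSet hr').image hf
  have hy' : y ∉ f '' omegaSet f^[m] x := by rintro ⟨z, hz, hzy⟩; exact h z hz hzy
  obtain ⟨u, v, hu, hv, hyu, hsv, hd⟩ := SeparatedNhds.of_isCompact_isCompact isCompact_singleton hcl
    (disjoint_singleton_left.2 hy')
  obtain ⟨N, hN⟩ := eventually_atTop.1 (eventually_mem_of_omegaSet_subset (x := x) hr'
    (hv.preimage hf) (image_subset_iff.1 hsv))
  obtain ⟨n, hn, hnu⟩ := exists_ge_of_mem_omegaSet hy (hu.mem_nhds (hyu rfl)) N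
  have hc : (f^[m])^[n] (f x) = f ((f^[m])^[n] x) := by
    rw [← Function.iterate_mul, ← Function.iterate_succ_apply, Function.iterate_succ_apply']
  rw [hc] at hnu
  exact disjoint_left.1 hd hnu (hN n hn)

theorem exists_preimage_omegaSet (hf : Continuous f) (hr : ∀ t, f t ∈ Icc a b) {y : ℝ}
    (hy : y ∈ omegaSet f x) : ∃ z ∈ omegaSet f x, f z = y := by
  rw [← omegaSet_apply] at hy
  exact exists_preimage_omegaSet_iterate (m := 1) hf hr one_pos hy

/-- Each part lies in the image of the preceding one, so a single finite part would make all later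
ones finite, and `m` consecutive parts cover the whole limit set. -/
theorem infinite_omegaSet_iterate (hf : Continuous f) (hr : ∀ t, f t ∈ Icc a b) {m : ℕ}
    (hm : 0 < m) (hW : (omegaSet f x).Infinite) (i : ℕ) :
    (omegaSet f^[m] (f^[i] x)).Infinite := by
  intro hfin
  have hall : ∀ k, (omegaSet f^[m] (f^[i + k] x)).Finite := by
    intro k
    induction k with
    | zero => exact hfin
    | succ k ih =>
      refine (ih.image f).subset fun y hy => ?_
      rw [← add_assoc, Function.iterate_succ_apply'] at hy
      exact exists_preimage_omegaSet_iterate hf hr hm hy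
  refine hW (((Finset.range m).finite_toSet.biUnion fun k _ => hall k).subset fun y hy => ?_)
  rw [← omegaSet_iterate_apply i] at hy
  obtain ⟨k, hk, hyk⟩ := exists_mem_omegaSet_iterate hm hy
  rw [← Function.iterate_add_apply, add_comm] at hyk
  exact mem_biUnion (Finset.mem_coe.2 (Finset.mem_range.2 hk)) hyk

/-- A point of an `ω`-limit set which is not fixed by `f` or `f ∘ f` is reached from a point that is
interior to the convex hull of the `ω`-limit set. -/
theorem exists_between_preimage_omegaSet (hf : Continuous f) (hr : ∀ t, f t ∈ Icc a b) {v : ℝ}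
    (hv : v ∈ omegaSet f x) (h1 : f v ≠ v) (h2 : f (f v) ≠ v) :
    ∃ w ∈ omegaSet f x, (∃ j, f^[j] w = v) ∧ (∃ p ∈ omegaSet f x, p < w) ∧
      ∃ q ∈ omegaSet f x, w < q := by
  obtain ⟨l, hl⟩ := (isCompact_omegaSet (x := x) hr).exists_isLeast (omegaSet_nonempty hr)
  obtain ⟨r, hrr⟩ := (isCompact_omegaSet (x := x) hr).exists_isGreatest (omegaSet_nonempty hr)
  have key : ∀ w ∈ omegaSet f x, w ≠ l → w ≠ r → (∃ j, f^[j] w = v) →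
      ∃ w ∈ omegaSet f x, (∃ j, f^[j] w = v) ∧ (∃ p ∈ omegaSet f x, p < w) ∧
      ∃ q ∈ omegaSet f x, w < q := fun w hw hwl hwr hj =>
    ⟨w, hw, hj, ⟨l, hl.1, lt_of_le_of_ne (hl.2 hw) (Ne.symm hwl)⟩,
      ⟨r, hrr.1, lt_of_le_of_ne (hrr.2 hw) hwr⟩⟩
  obtain ⟨v1, hv1, hv1v⟩ := exists_preimage_omegaSet hf hr hv
  obtain ⟨v2, hv2, hv2v⟩ := exists_preimage_omegaSet hf hr hv1
  have n1 : v1 ≠ v := by rintro rfl; exact h1 hv1v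
  have n2 : v2 ≠ v1 := by rintro rfl; exact n1 (hv2v.symm.trans hv1v)
  have n3 : v2 ≠ v := by rintro rfl; rw [hv2v, hv1v] at h2; exact h2 rfl
  by_cases c0 : v ≠ l ∧ v ≠ r
  · exact key v hv c0.1 c0.2 ⟨0, rfl⟩
  by_cases c1 : v1 ≠ l ∧ v1 ≠ r
  · exact key v1 hv1 c1.1 c1.2 ⟨1, hv1v⟩
  by_cases c2 : v2 ≠ l ∧ v2 ≠ r
  · exact key v2 hv2 c2.1 c2.2 ⟨2, by simp [hv2v, hv1v]⟩
  -- Now `v`, `v1`, `v2` all lie in `{l, r}`, although they are pairwise distinct.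
  exfalso
  grind

end omegaSet

/-! ### Orbits of tame maps and fixed points in limit sets -/

section orbits

variable {f : ℝ → ℝ} {x a b : ℝ}

theorem iterate_mem_of_mapsTo {S : Set ℝ} (h : ∀ t ∈ S, f t ∈ S) (hx : x ∈ S) (n : ℕ) :
    f^[n] x ∈ S := by
  induction n with
  | zero => exact hx
  | succ n ih => rw [Function.iterate_succ_apply']; exact h _ ih

/-- In a non-turbulent system no orbit leads from a point moving right to a point further left
that moves left. -/
theorem not_lt_of_up_of_down (hf : Continuous f) (hT : ¬ Turbulent f) {y : ℝ} {m : ℕ}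
    (hy : y < f y) (hw : f (f^[m] y) < f^[m] y) : ¬ f^[m] y < y := by
  intro hwy
  set w := f^[m] y with hw_def
  -- The last point of `[w, y]` not moving right is a fixed point `q`. The orbit has to jump across
  -- it from the right.
  obtain ⟨q, ⟨hqI, hqf⟩, hq⟩ := (isCompact_Icc.inter_right (isClosed_le hf continuous_id) :
    IsCompact (Icc w y ∩ {t | f t ≤ t})).exists_isGreatest ⟨w, ⟨le_rfl, hwy.le⟩, hw.le⟩
  have hqf' : f q ≤ q := hqf
  have hqy : q < y := lt_of_le_of_ne hqI.2 (by rintro rfl; linarith)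
  have hup : ∀ t, q < t → t ≤ y → t < f t := by
    intro t h1 h2
    by_contra h3
    exact absurd (hq ⟨⟨hqI.1.trans h1.le, h2⟩, not_lt.1 h3⟩) (not_le.2 h1)
  have hfq : f q = q := by
    obtain ⟨t, ht, ht0⟩ := intermediate_value_Icc hqy.le (hf.sub continuous_id).continuousOn
      (show (0 : ℝ) ∈ Icc (f q - id q) (f y - id y) from
        ⟨by simp only [id]; linarith, by simp only [id]; linarith⟩)
    have htf : f t = t := by simpa [sub_eq_zero] using ht0
    rcases ht.1.eq_or_lt with rfl | hlt
    · exact htf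
    · exact absurd (hup t hlt ht.2) (by rw [htf]; exact lt_irrefl t)
  have hwq : w < q := lt_of_le_of_ne hqI.1 (by intro h; rw [h] at hw; linarith)
  obtain ⟨t0, ht0, hft0⟩ : ∃ t0, y ≤ t0 ∧ f t0 ≤ q := by
    by_contra! h
    have : w ∈ Ioi q := iterate_mem_of_mapsTo (S := Ioi q) (fun t ht => by
      rcases le_total t y with h' | h'
      · exact lt_trans ht (hup t ht h')
      · exact h t h') hqy m
    exact absurd this (not_lt.2 hwq.le)
  -- Let `c` be the first point beyond `y` that is sent to `q` or below. If no point of `(q, c)`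
  -- reached `c`, this interval would trap the orbit, so `q < d < c` exhibits turbulence.
  obtain ⟨c, ⟨hcI, hcf⟩, hc⟩ := (isCompact_Icc.inter_right (isClosed_le hf continuous_const) :
    IsCompact (Icc y t0 ∩ {t | f t ≤ q})).exists_isLeast ⟨t0, ⟨ht0, le_rfl⟩, hft0⟩
  have hcf' : f c ≤ q := hcf
  have hyc : y < c := lt_of_le_of_ne hcI.1 (by rintro rfl; linarith)
  have hgt : ∀ t, q < t → t < c → q < f t := by
    intro t h1 h2
    rcases le_total t y with h' | h'
    · exact h1.trans (hup t h1 h')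
    · by_contra h3
      exact absurd (hc ⟨⟨h', h2.le.trans hcI.2⟩, not_lt.1 h3⟩) (not_le.2 h2)
  obtain ⟨d, hqd, hdc, hfd⟩ : ∃ d, q < d ∧ d < c ∧ c ≤ f d := by
    by_contra! h
    have : w ∈ Ioo q c := iterate_mem_of_mapsTo (S := Ioo q c)
      (fun t ht => ⟨hgt t ht.1 ht.2, h t ht.1 ht.2⟩) ⟨hqy, hyc⟩ m
    exact absurd this.1 (not_lt.2 hwq.le)
  exact hT (turbulent_of_left hf hqd hdc hfq.le hfd hcf')

theorem not_lt_of_down_of_up (hf : Continuous f) (hT : ¬ Turbulent f) {y : ℝ} {m : ℕ}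
    (hy : f y < y) (hw : f^[m] y < f (f^[m] y)) : ¬ y < f^[m] y := by
  have := not_lt_of_up_of_down (continuous_reflect hf) (not_turbulent_reflect hT) (y := -y) (m := m)
    (by simpa [reflect] using hy) (by rw [reflect_iterate]; simpa [reflect] using hw)
  rw [reflect_iterate] at this
  simpa [reflect] using this

/-- In a non-turbulent system, the points of an orbit that move right lie to the left of those that
move left. -/
theorem up_lt_down (hf : Continuous f) (hT : ¬ Turbulent f) {i j : ℕ}
    (hi : f^[i] x < f (f^[i] x)) (hj : f (f^[j] x) < f^[j] x) : f^[i] x < f^[j] x := by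
  have hne : f^[i] x ≠ f^[j] x := by intro h; rw [h] at hi; exact lt_asymm hi hj
  refine lt_of_le_of_ne (not_lt.1 fun hlt => ?_) hne
  rcases le_total i j with h | h
  · obtain ⟨m, rfl⟩ := Nat.exists_eq_add_of_le' h
    rw [Function.iterate_add_apply] at hj hlt
    exact not_lt_of_up_of_down hf hT hi hj hlt
  · obtain ⟨m, rfl⟩ := Nat.exists_eq_add_of_le' h
    rw [Function.iterate_add_apply] at hi hlt
    exact not_lt_of_down_of_up hf hT hj hi hlt

theorem exists_ge_lt_apply (hr : ∀ t, f t ∈ Icc a b) (hW : (omegaSet f x).Infinite) (N : ℕ) :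
    ∃ n ≥ N, f^[n] x < f (f^[n] x) := by
  by_contra! h
  -- Otherwise the orbit is eventually decreasing and converges. Starting at `N + 1` keeps it in
  -- `[a, b]` even if `x` is outside.
  have hanti : Antitone fun n => f^[n] (f^[N + 1] x) := antitone_nat_of_succ_le fun n => by
    rw [Function.iterate_succ_apply', ← Function.iterate_add_apply]
    exact h _ (by omega)
  have hbdd : BddBelow (range fun n => f^[n] (f^[N + 1] x)) := by
    refine ⟨a, ?_⟩
    rintro _ ⟨n, rfl⟩
    change a ≤ f^[n] _
    rw [← Function.iterate_add_apply]
    exact (iterate_mem_Icc hr (by omega) x).1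
  have := omegaSet_subset_of_tendsto (tendsto_atTop_ciInf hanti hbdd)
  rw [omegaSet_iterate_apply] at this
  exact hW ((finite_singleton _).subset this)

theorem iterate_fixed {q : ℝ} (hq : f q = q) (n : ℕ) : f^[n] q = q :=
  Function.iterate_fixed hq n

/-- If a fixed point `q` belongs to an infinite `ω`-limit set of a tame map, then no point of the
orbit to the left of `q` moves left. -/
theorem not_down_of_lt_fixed (hf : Continuous f) (hr : ∀ t, f t ∈ Icc a b) (hT : Tame f) {q : ℝ}
    (hq : f q = q) (hqW : q ∈ omegaSet f x) (hW : (omegaSet f x).Infinite) (hxq : x < q) :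
    ¬ f x < x := by
  intro hx
  have hup : ∀ k, f^[k] x < f (f^[k] x) → f^[k] x < x := fun k hk =>
    up_lt_down hf hT.not_turbulent (j := 0) hk hx
  -- The orbit accumulates at `q`, but right-moving points lie left of `x`. Getting above `q - ε`
  -- therefore takes a single jump from the left of `x`.
  have hjump : ∀ N, ∀ ε > 0, ∃ j ≥ N, f^[j] x < x ∧ q - ε < f (f^[j] x) := by
    intro N ε hε
    obtain ⟨k0, hk0, hk0u⟩ := exists_ge_lt_apply hr hW N
    by_contra! h
    have hle : ∀ k, f^[k + (k0 + 1)] x ≤ q - ε := by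
      intro k
      induction k with
      | zero =>
        rw [zero_add, Function.iterate_succ_apply']
        exact h k0 hk0 (hup _ hk0u)
      | succ k ih =>
        rw [show k + 1 + (k0 + 1) = (k + (k0 + 1)) + 1 by omega, Function.iterate_succ_apply']
        rcases lt_or_ge (f^[k + (k0 + 1)] x) (f (f^[k + (k0 + 1)] x)) with h1 | h1
        · exact h _ (by omega) (hup _ h1)
        · exact h1.trans ih
    obtain ⟨n, hn, hnq⟩ := exists_ge_of_mem_omegaSet hqW
      (lt_mem_nhds (show q - ε < q by linarith)) (k0 + 1)
    have := hle (n - (k0 + 1))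
    rw [Nat.sub_add_cancel hn] at this
    linarith
  obtain ⟨u, huW, hux, hfu⟩ : ∃ u ∈ omegaSet f x, u ≤ x ∧ q ≤ f u := by
    by_contra! h
    obtain ⟨ε, hε, hεW⟩ : ∃ ε > 0, ∀ u ∈ omegaSet f x, u ≤ x → f u < q - ε := by
      rcases (omegaSet f x ∩ Iic x).eq_empty_or_nonempty with he | hne
      · exact ⟨1, one_pos, fun u hu hux => absurd (show u ∈ omegaSet f x ∩ Iic x from ⟨hu, hux⟩)
          (by simp [he])⟩
      · obtain ⟨c, hc, hmax⟩ := ((isCompact_omegaSet hr).inter_right isClosed_Iic).exists_isMaxOn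
          hne hf.continuousOn
        have := h c hc.1 hc.2
        refine ⟨(q - f c) / 2, by linarith, fun u hu hux => ?_⟩
        have : f u ≤ f c := hmax ⟨hu, hux⟩
        linarith
    have hO : IsOpen ({t | x < t} ∪ {t | f t < q - ε}) :=
      (isOpen_lt continuous_const continuous_id).union (isOpen_lt hf continuous_const)
    obtain ⟨N, hN⟩ := eventually_atTop.1 (eventually_mem_of_omegaSet_subset (x := x) hr hO
      fun u hu => (lt_or_ge x u).imp id (hεW u hu))
    obtain ⟨j, hj, hjx, hjq⟩ := hjump N ε hε
    rcases hN j hj with h1 | h1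
    · exact lt_asymm hjx h1
    · exact lt_asymm hjq h1
  obtain ⟨v, hv, hvq⟩ := intermediate_value_Icc' hux hf.continuousOn
    (show q ∈ Icc (f x) (f u) from ⟨by linarith, hfu⟩)
  have hvx : v < x := lt_of_le_of_ne hv.2 (by rintro rfl; linarith)
  have hvlt : v < q := hvx.trans hxq
  have hit : ∀ k, 0 < k → f^[k] v = q := by
    intro k hk
    obtain ⟨k, rfl⟩ : ∃ l, k = l + 1 := ⟨k - 1, by omega⟩
    rw [Function.iterate_succ_apply, hvq, iterate_fixed hq]
  -- The positive iterates of `f` send both `v` and `q` to `q`, so a point between them sent to `v`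
  -- or below gives turbulence.
  have hturb : ∀ k, 0 < k → ∀ t, v < t → t < q → ¬ f^[k] t ≤ v := fun k hk t h1 h2 h3 =>
    hT k (turbulent_of_right (hf.iterate k) h1 h2 (hit k hk).ge h3 (iterate_fixed hq k).ge)
  have hge : ∀ k, v ≤ f^[k] x := by
    intro k
    rcases Nat.eq_zero_or_pos k with rfl | hk
    · exact hvx.le
    · exact (not_le.1 (hturb k hk x hvx hxq)).le
  have hWge : omegaSet f x ⊆ Ici v := omegaSet_subset isClosed_Ici (Eventually.of_forall hge)
  have huv : u = v := le_antisymm hv.1 (hWge huW)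
  subst huv
  obtain ⟨w, hw, ⟨j, hj⟩, ⟨p, hp, hpw⟩, ⟨r, hr', hwr⟩⟩ := exists_between_preimage_omegaSet hf hr huW
    (by rw [hvq]; exact hvlt.ne') (by rw [hvq, hq]; exact hvlt.ne')
  have hjpos : 0 < j := by
    rcases Nat.eq_zero_or_pos j with rfl | h
    · have h1 : w = u := hj
      have h2 : u ≤ p := hWge hp
      linarith
    · exact h
  -- The images of `[u, q]` all contain `q`, so their union is an interval; it contains the orbit
  -- and hence `w`. Since `w` is later sent to `u`, some `t` strictly between `u` and `q` reaches
  -- `u`, against `hturb`.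
  have hZ : IsPreconnected (⋃ i, f^[i] '' Icc u q) := by
    refine isPreconnected_iUnion ⟨q, mem_iInter.2 fun i =>
      ⟨q, right_mem_Icc.2 hvlt.le, iterate_fixed hq i⟩⟩ fun i =>
      isPreconnected_Icc.image _ (hf.iterate i).continuousOn
  have hxZ : ∀ k, f^[k] x ∈ ⋃ i, f^[i] '' Icc u q := fun k =>
    mem_iUnion.2 ⟨k, x, ⟨hvx.le, hxq.le⟩, rfl⟩
  obtain ⟨k1, -, hk1⟩ := exists_ge_of_mem_omegaSet hp (gt_mem_nhds hpw) 0
  obtain ⟨k2, -, hk2⟩ := exists_ge_of_mem_omegaSet hr' (lt_mem_nhds hwr) 0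
  obtain ⟨i, t, ht, htw⟩ := mem_iUnion.1 (hZ.Icc_subset (hxZ k1) (hxZ k2) ⟨hk1.le, hk2.le⟩)
  have hcyc : f^[j + i] t = u := by rw [Function.iterate_add_apply, htw, hj]
  have htu : u < t := lt_of_le_of_ne ht.1 (by
    rintro rfl; rw [hit _ (by omega)] at hcyc; exact hvlt.ne' hcyc)
  have htq : t < q := lt_of_le_of_ne ht.2 (by
    rintro rfl; rw [iterate_fixed hq] at hcyc; exact hvlt.ne' hcyc)
  exact hturb _ (by omega) t htu htq hcyc.le

theorem not_up_of_fixed_lt (hf : Continuous f) (hr : ∀ t, f t ∈ Icc a b) (hT : Tame f) {q : ℝ}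
    (hq : f q = q) (hqW : q ∈ omegaSet f x) (hW : (omegaSet f x).Infinite) (hxq : q < x) :
    ¬ x < f x := by
  have hW' : (omegaSet (reflect f) (-x)).Infinite := by
    have : omegaSet (reflect f) (-x) = Neg.neg ⁻¹' omegaSet f x := by
      ext y; exact mem_omegaSet_reflect
    rw [this]
    exact hW.preimage (by simp)
  have := not_down_of_lt_fixed (continuous_reflect hf) (a := -b) (b := -a) (x := -x) (q := -q)
    (fun t => ⟨neg_le_neg (hr _).2, neg_le_neg (hr _).1⟩) hT.reflect (by simp [reflect, hq])
    (by rw [mem_omegaSet_reflect, neg_neg]; exact hqW) hW' (neg_lt_neg hxq)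
  simpa [reflect] using this

/-- An `ω`-limit set of a tame map that contains a fixed point is finite. -/
theorem omegaSet_finite_of_fixed (hf : Continuous f) (hr : ∀ t, f t ∈ Icc a b) (hT : Tame f)
    {q : ℝ} (hq : f q = q) (hqW : q ∈ omegaSet f x) : (omegaSet f x).Finite := by
  by_contra hW
  have hqm : ∀ n m, 0 < m → q ∈ omegaSet f^[m] (f^[n] x) := by
    intro n m hm
    obtain ⟨i, -, hi⟩ := exists_mem_omegaSet_iterate hm hqW
    -- This shift brings the index to `n + m * i`, which is `n` modulo `m`, without moving the fixed
    -- point.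
    have h1 := map_mem_omegaSet_iterate hf (n + (m - 1) * i) hi
    rw [iterate_fixed hq, ← Function.iterate_add_apply] at h1
    rwa [omegaSet_iterate_congr (j := n)] at h1
    obtain ⟨m, rfl⟩ : ∃ l, m = l + 1 := ⟨m - 1, by omega⟩
    have : n + (m + 1 - 1) * i + i = n + (m + 1) * i := by rw [Nat.add_sub_cancel]; ring
    rw [this]
    exact Nat.modEq_iff_dvd.2 ⟨-i, by push_cast; ring⟩
  have hne : ∀ n m, 0 < m → f^[m] (f^[n] x) ≠ f^[n] x := fun n m hm h =>
    hW (omegaSet_finite_of_iterate_eq hm (by rw [add_comm, Function.iterate_add_apply, h]))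
  have hl : ∀ n m, 0 < m → f^[n] x < q → f^[n] x < f^[m] (f^[n] x) := fun n m hm h =>
    lt_of_le_of_ne (not_lt.1 (not_down_of_lt_fixed (hf.iterate m) (iterate_mem_Icc hr hm)
      (hT.iterate m) (iterate_fixed hq m) (hqm n m hm)
      (infinite_omegaSet_iterate hf hr hm hW n) h)) (hne n m hm).symm
  have hg : ∀ n m, 0 < m → q < f^[n] x → f^[m] (f^[n] x) < f^[n] x := fun n m hm h =>
    lt_of_le_of_ne (not_lt.1 (not_up_of_fixed_lt (hf.iterate m) (iterate_mem_Icc hr hm)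
      (hT.iterate m) (iterate_fixed hq m) (hqm n m hm)
      (infinite_omegaSet_iterate hf hr hm hW n) h)) (hne n m hm)
  -- An orbit point left of `q` is never followed by a lower one, since it moves right under every
  -- iterate. The orbit thus cannot accumulate at two points on this side.
  have hL : (omegaSet f x ∩ Iio q).Subsingleton := by
    have : ∀ w1 ∈ omegaSet f x ∩ Iio q, ∀ w2 ∈ omegaSet f x ∩ Iio q, ¬ w1 < w2 := by
      intro w1 h1 w2 h2 hlt
      obtain ⟨c, hc1, hc2⟩ := exists_between hlt
      obtain ⟨n, -, hn⟩ := exists_ge_of_mem_omegaSet h2.1 (Ioo_mem_nhds hc2 h2.2) 0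
      obtain ⟨k, hk, hkc⟩ := exists_ge_of_mem_omegaSet h1.1 (gt_mem_nhds hc1) (n + 1)
      have := hl n (k - n) (by omega) hn.2
      rw [← Function.iterate_add_apply, Nat.sub_add_cancel (by omega)] at this
      linarith [hn.1]
    exact fun w1 h1 w2 h2 => le_antisymm (not_lt.1 (this w2 h2 w1 h1)) (not_lt.1 (this w1 h1 w2 h2))
  have hR : (omegaSet f x ∩ Ioi q).Subsingleton := by
    have : ∀ w1 ∈ omegaSet f x ∩ Ioi q, ∀ w2 ∈ omegaSet f x ∩ Ioi q, ¬ w1 < w2 := by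
      intro w1 h1 w2 h2 hlt
      obtain ⟨c, hc1, hc2⟩ := exists_between hlt
      obtain ⟨n, -, hn⟩ := exists_ge_of_mem_omegaSet h1.1 (Ioo_mem_nhds h1.2 hc1) 0
      obtain ⟨k, hk, hkc⟩ := exists_ge_of_mem_omegaSet h2.1 (lt_mem_nhds hc2) (n + 1)
      have := hg n (k - n) (by omega) hn.1
      rw [← Function.iterate_add_apply, Nat.sub_add_cancel (by omega)] at this
      linarith [hn.2]
    exact fun w1 h1 w2 h2 => le_antisymm (not_lt.1 (this w2 h2 w1 h1)) (not_lt.1 (this w1 h1 w2 h2))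
  refine hW (((hL.finite.union hR.finite).union (finite_singleton q)).subset fun w hw => ?_)
  rcases lt_trichotomy w q with h | h | h
  · exact Or.inl (Or.inl ⟨hw, h⟩)
  · exact Or.inr h
  · exact Or.inl (Or.inr ⟨hw, h⟩)

theorem iterate_ne_of_mem_omegaSet (hf : Continuous f) (hr : ∀ t, f t ∈ Icc a b) (hT : Tame f)
    (hW : (omegaSet f x).Infinite) {w : ℝ} (hw : w ∈ omegaSet f x) {m : ℕ} (hm : 0 < m) :
    f^[m] w ≠ w := fun h => by
  obtain ⟨i, -, hi⟩ := exists_mem_omegaSet_iterate hm hw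
  exact infinite_omegaSet_iterate hf hr hm hW i
    (omegaSet_finite_of_fixed (hf.iterate m) (iterate_mem_Icc hr hm) (hT.iterate m) h hi)

/-- For a tame map, an infinite `ω`-limit set splits into two parts, separated by a point `p`, that
are interchanged by the map. -/
theorem exists_swap_point (hf : Continuous f) (hr : ∀ t, f t ∈ Icc a b) (hT : Tame f)
    (hW : (omegaSet f x).Infinite) :
    ∃ p, ∀ w ∈ omegaSet f x, w < p ∧ p < f w ∨ p < w ∧ f w < p := by
  set W := omegaSet f x with hWdef
  have hWc : IsCompact W := isCompact_omegaSet hr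
  have hWne : W.Nonempty := omegaSet_nonempty hr
  have hmap : ∀ w ∈ W, f w ∈ W := fun w hw => map_mem_omegaSet hf 1 hw
  have hne1 : ∀ w ∈ W, f w ≠ w := fun w hw =>
    iterate_ne_of_mem_omegaSet hf hr hT hW hw (m := 1) one_pos
  have hne2 : ∀ w ∈ W, f (f w) ≠ w := fun w hw =>
    iterate_ne_of_mem_omegaSet hf hr hT hW hw (m := 2) two_pos
  obtain ⟨c, hc, hcmax⟩ : ∃ c, IsGreatest (W ∩ {t | t ≤ f t}) c := by
    refine (hWc.inter_right (isClosed_le continuous_id hf)).exists_isGreatest ?_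
    obtain ⟨l, hl⟩ := hWc.exists_isLeast hWne
    exact ⟨l, hl.1, hl.2 (hmap l hl.1)⟩
  obtain ⟨d, hd, hdmin⟩ : ∃ d, IsLeast (W ∩ {t | f t ≤ t}) d := by
    refine (hWc.inter_right (isClosed_le hf continuous_id)).exists_isLeast ?_
    obtain ⟨l, hl⟩ := hWc.exists_isGreatest hWne
    exact ⟨l, hl.1, hl.2 (hmap l hl.1)⟩
  have hcf : c < f c := lt_of_le_of_ne hc.2 (hne1 c hc.1).symm
  have hdf : f d < d := lt_of_le_of_ne hd.2 (hne1 d hd.1)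
  have hcd : c < d := by
    have hcd' : c ≠ d := by rintro rfl; exact lt_asymm hcf hdf
    refine lt_of_le_of_ne (not_lt.1 fun hlt => ?_) hcd'
    obtain ⟨e, he1, he2⟩ := exists_between hlt
    obtain ⟨n, -, hn⟩ := exists_ge_of_mem_omegaSet hc.1 ((lt_mem_nhds he2).and
      ((isOpen_lt continuous_id hf).mem_nhds hcf)) 0
    obtain ⟨k, -, hk⟩ := exists_ge_of_mem_omegaSet hd.1 ((gt_mem_nhds he1).and
      ((isOpen_lt hf continuous_id).mem_nhds hdf)) 0
    have := up_lt_down hf hT.not_turbulent hn.2 hk.2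
    linarith [hn.1, hk.1]
  have hside : ∀ w ∈ W, w ≤ c ∨ d ≤ w := fun w hw =>
    (le_total w (f w)).imp (fun h => hcmax ⟨hw, h⟩) (fun h => hdmin ⟨hw, h⟩)
  have hfc : d ≤ f c := (hside _ (hmap c hc.1)).resolve_left (not_le.2 hcf)
  have hfd : f d ≤ c := (hside _ (hmap d hd.1)).resolve_right (not_le.2 hdf)
  have hcdI : c ∈ Icc c d ∧ d ∈ Icc c d := ⟨left_mem_Icc.2 hcd.le, right_mem_Icc.2 hcd.le⟩
  have hcover : Icc c d ⊆ f '' Icc c d := Icc_subset_image hf hcdI.2 hcdI.1 hfd hfc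
  have hsucc : ∀ (S : Set ℝ) n, Icc c d ⊆ f '' S → f^[n] '' Icc c d ⊆ f^[n + 1] '' S := by
    intro S n hS
    rw [Function.iterate_succ, image_comp]
    exact image_mono hS
  have hK : ∀ n, Icc c d ⊆ f^[n] '' Icc c d := by
    intro n
    induction n with
    | zero => simp
    | succ n ih => exact ih.trans (hsucc _ n hcover)
  set T := ⋃ n, f^[n] '' Icc c d with hTdef
  have hTpre : IsPreconnected T := isPreconnected_iUnion
    ⟨c, mem_iInter.2 fun i => hK i hcdI.1⟩ fun i =>
      isPreconnected_Icc.image _ (hf.iterate i).continuousOn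
  have hTinv : ∀ t ∈ T, f t ∈ T := by
    intro t ht
    obtain ⟨n, y, hy, rfl⟩ := mem_iUnion.1 ht
    exact mem_iUnion.2 ⟨n + 1, y, hy, Function.iterate_succ_apply' f n y⟩
  have hIcc1 : Icc (f d) (f c) ⊆ T := fun t ht => mem_iUnion.2
    ⟨1, Icc_subset_image hf hcdI.2 hcdI.1 le_rfl le_rfl ht⟩
  -- The interval `[f d, f c]` is a neighbourhood of `c` or of `d`, unless `c` and `d` form a
  -- 2-cycle, which `hne2` excludes.
  obtain ⟨N, hN⟩ : ∃ N, f^[N] x ∈ T := by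
    by_cases hfc' : f c = d
    · have : f d < c := lt_of_le_of_ne hfd fun h => hne2 c hc.1 (by rw [hfc', h])
      obtain ⟨N, -, hN⟩ := exists_ge_of_mem_omegaSet hc.1 (Icc_mem_nhds this hcf) 0
      exact ⟨N, hIcc1 hN⟩
    · obtain ⟨N, -, hN⟩ := exists_ge_of_mem_omegaSet hd.1
        (Icc_mem_nhds hdf (lt_of_le_of_ne hfc (Ne.symm hfc'))) 0
      exact ⟨N, hIcc1 hN⟩
  have hNge : ∀ n ≥ N, f^[n] x ∈ T := fun n hn => by
    rw [← Nat.sub_add_cancel hn, Function.iterate_add_apply]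
    exact iterate_mem_of_mapsTo hTinv hN _
  have hWT : ∀ w ∈ W, w ∈ T := by
    intro w hw
    obtain ⟨v, hv, ⟨j, rfl⟩, ⟨p, hp, hpv⟩, ⟨q, hq, hvq⟩⟩ :=
      exists_between_preimage_omegaSet hf hr hw (hne1 w hw) (hne2 w hw)
    obtain ⟨k1, h1, hk1⟩ := exists_ge_of_mem_omegaSet hp (gt_mem_nhds hpv) N
    obtain ⟨k2, h2, hk2⟩ := exists_ge_of_mem_omegaSet hq (lt_mem_nhds hvq) N
    exact iterate_mem_of_mapsTo hTinv
      (hTpre.Icc_subset (hNge k1 h1) (hNge k2 h2) ⟨hk1.le, hk2.le⟩) j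
  have hKpre : ∀ n, IsPreconnected (f^[n] '' Icc c d) := fun n =>
    isPreconnected_Icc.image _ (hf.iterate n).continuousOn
  have hU : ∀ w ∈ W, w ≤ c → d ≤ f w := by
    intro w hw hwc
    refine (hside _ (hmap w hw)).resolve_left fun hfw => ?_
    have hwc' : w < c := lt_of_le_of_ne hwc (by rintro rfl; linarith)
    obtain ⟨n, hn⟩ := mem_iUnion.1 (hWT w hw)
    have hsub : Icc w d ⊆ f^[n] '' Icc c d := (hKpre n).Icc_subset hn (hK n hcdI.2)
    -- Both `[w, c]` and `[c, d]` cover `[c, d]` under `f`, and `f^[n]` stretches `[c, d]` over `[w,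
    -- d]`, so `f^[n + 1]` is turbulent.
    exact hT (n + 1) ⟨w, c, d, hwc', hcd,
      hsub.trans (hsucc _ n (Icc_subset_image hf (left_mem_Icc.2 hwc) (right_mem_Icc.2 hwc) hfw hfc)),
      hsub.trans (hsucc _ n hcover)⟩
  have hD : ∀ w ∈ W, d ≤ w → f w ≤ c := by
    intro w hw hwd
    refine (hside _ (hmap w hw)).resolve_right fun hfw => ?_
    have hwd' : d < w := lt_of_le_of_ne hwd (by rintro rfl; linarith)
    obtain ⟨n, hn⟩ := mem_iUnion.1 (hWT w hw)
    have hsub : Icc c w ⊆ f^[n] '' Icc c d := (hKpre n).Icc_subset (hK n hcdI.1) hn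
    exact hT (n + 1) ⟨c, d, w, hcd, hwd', hsub.trans (hsucc _ n hcover),
      hsub.trans (hsucc _ n
        (Icc_subset_image hf (left_mem_Icc.2 hwd) (right_mem_Icc.2 hwd) hfd hfw))⟩
  obtain ⟨p, hp1, hp2⟩ := exists_between hcd
  refine ⟨p, fun w hw => (hside w hw).imp (fun h => ?_) fun h => ?_⟩
  · exact ⟨h.trans_lt hp1, hp2.trans_le (hU w hw h)⟩
  · exact ⟨hp2.trans_le h, (hD w hw h).trans_lt hp1⟩

/-! ### Splitting a limit set into separated parts -/

/-- Two sets of reals one of which lies entirely to the left of the other. -/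
def Separated (A B : Set ℝ) : Prop := (∀ u ∈ A, ∀ v ∈ B, u < v) ∨ ∀ u ∈ A, ∀ v ∈ B, v < u

theorem Separated.symm {A B : Set ℝ} (h : Separated A B) : Separated B A :=
  (Or.symm h).imp (fun h u hu v hv => h v hv u hu) fun h u hu v hv => h v hv u hu

theorem Separated.mono {A B A' B' : Set ℝ} (h : Separated A B) (hA : A' ⊆ A) (hB : B' ⊆ B) :
    Separated A' B' :=
  h.imp (fun h u hu v hv => h u (hA hu) v (hB hv)) fun h u hu v hv => h u (hA hu) v (hB hv)

/-- The swap is an open condition, so it holds along the orbit from some time on. Even and odd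
iterates then stay on opposite sides of `p`, and `p` itself is not a limit point. -/
theorem separated_omegaSet_sq (hf : Continuous f) (hr : ∀ t, f t ∈ Icc a b) (hT : Tame f)
    (hW : (omegaSet f x).Infinite) : Separated (omegaSet f^[2] x) (omegaSet f^[2] (f x)) := by
  obtain ⟨p, hp⟩ := exists_swap_point hf hr hT hW
  have hO : IsOpen ({t | t < p} ∩ {t | p < f t} ∪ {t | p < t} ∩ {t | f t < p}) :=
    ((isOpen_lt continuous_id continuous_const).inter (isOpen_lt continuous_const hf)).union
      ((isOpen_lt continuous_const continuous_id).inter (isOpen_lt hf continuous_const))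
  obtain ⟨N, hN⟩ := eventually_atTop.1 (eventually_mem_of_omegaSet_subset (x := x) hr hO hp)
  have hsub0 : omegaSet f^[2] x ⊆ omegaSet f x := omegaSet_iterate_subset two_pos 0
  have hsub1 : omegaSet f^[2] (f x) ⊆ omegaSet f x := omegaSet_iterate_subset two_pos 1
  have hpW : p ∉ omegaSet f x := fun h => by rcases hp p h with h | h <;> exact lt_irrefl _ h.1
  have hlim : ∀ y : ℝ, omegaSet f^[2] y ⊆ omegaSet f x →
      ((∀ k ≥ N, (f^[2])^[k] y < p) → ∀ w ∈ omegaSet f^[2] y, w < p) ∧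
      ((∀ k ≥ N, p < (f^[2])^[k] y) → ∀ w ∈ omegaSet f^[2] y, p < w) := by
    intro y hy
    refine ⟨fun h w hw => lt_of_le_of_ne ?_ ?_, fun h w hw => lt_of_le_of_ne ?_ ?_⟩
    · exact omegaSet_subset isClosed_Iic
        ((eventually_ge_atTop N).mono fun k hk => (h k hk).le) hw
    · rintro rfl; exact hpW (hy hw)
    · exact omegaSet_subset isClosed_Ici
        ((eventually_ge_atTop N).mono fun k hk => (h k hk).le) hw
    · rintro rfl; exact hpW (hy hw)
  have hev : ∀ k, (f^[2])^[k] x = f^[2 * k] x := fun k => by rw [← Function.iterate_mul]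
  have hod : ∀ k, (f^[2])^[k] (f x) = f^[2 * k + 1] x := fun k => by
    rw [← Function.iterate_mul, Function.iterate_succ_apply]
  have hLR : ∀ n ≥ N, f^[n] x < p → p < f^[n + 1] x := by
    intro n hn h
    rw [Function.iterate_succ_apply']
    rcases hN n hn with h' | h'
    · exact h'.2
    · exact absurd h'.1 (lt_asymm h)
  have hRL : ∀ n ≥ N, p < f^[n] x → f^[n + 1] x < p := by
    intro n hn h
    rw [Function.iterate_succ_apply']
    rcases hN n hn with h' | h'
    · exact absurd h'.1 (lt_asymm h)
    · exact h'.2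
  have hstart : f^[2 * N] x < p ∨ p < f^[2 * N] x :=
    (hN (2 * N) (by omega)).imp (fun h => h.1) (fun h => h.1)
  rcases hstart with hs | hs
  · have he : ∀ k ≥ N, f^[2 * k] x < p := by
      intro k hk
      induction k, hk using Nat.le_induction with
      | base => exact hs
      | succ k hk ih => exact hRL (2 * k + 1) (by omega) (hLR (2 * k) (by omega) ih)
    refine Or.inl fun u hu v hv => lt_trans ((hlim x hsub0).1 (fun k hk => ?_) u hu)
      ((hlim (f x) hsub1).2 (fun k hk => ?_) v hv)
    · rw [hev]; exact he k hk
    · rw [hod]; exact hLR _ (by omega) (he k hk)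
  · have he : ∀ k ≥ N, p < f^[2 * k] x := by
      intro k hk
      induction k, hk using Nat.le_induction with
      | base => exact hs
      | succ k hk ih => exact hLR (2 * k + 1) (by omega) (hRL (2 * k) (by omega) ih)
    refine Or.inr fun u hu v hv => lt_trans ((hlim (f x) hsub1).1 (fun k hk => ?_) v hv)
      ((hlim x hsub0).2 (fun k hk => ?_) u hu)
    · rw [hod]; exact hRL _ (by omega) (he k hk)
    · rw [hev]; exact he k hk

/-- For a tame map, an infinite `ω`-limit set splits into `2 ^ k` cyclically permuted parts with
disjoint convex hulls. -/
theorem separated_omegaSet_two_pow (hf : Continuous f) (hr : ∀ t, f t ∈ Icc a b) (hT : Tame f)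
    (hW : (omegaSet f x).Infinite) (k : ℕ) {i j : ℕ} (hij : ¬ i ≡ j [MOD 2 ^ k]) :
    Separated (omegaSet f^[2 ^ k] (f^[i] x)) (omegaSet f^[2 ^ k] (f^[j] x)) := by
  induction k generalizing i j with
  | zero => exact absurd (Nat.modEq_one) hij
  | succ k ih =>
    have hm : 0 < 2 ^ k := by positivity
    have hpow : f^[2 ^ (k + 1)] = (f^[2 ^ k])^[2] := by
      rw [← Function.iterate_mul, pow_succ]
    have hsub : ∀ i, omegaSet f^[2 ^ (k + 1)] (f^[i] x) ⊆ omegaSet f^[2 ^ k] (f^[i] x) := by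
      intro i
      rw [hpow]
      exact omegaSet_iterate_subset (f := f^[2 ^ k]) two_pos 0
    by_cases hij' : i ≡ j [MOD 2 ^ k]
    · wlog hle : i ≤ j generalizing i j
      · exact (this (fun h => hij h.symm) hij'.symm (not_le.1 hle).le).symm
      obtain ⟨c, hc⟩ := (Nat.modEq_iff_dvd' hle).1 hij'
      have hodd : ¬ Even c := by
        rintro ⟨e, rfl⟩
        exact hij ((Nat.modEq_iff_dvd' hle).2 ⟨e, by rw [hc]; ring⟩)
      obtain ⟨e, rfl⟩ := Nat.not_even_iff_odd.1 hodd
      -- The indices differ by an odd multiple of `2 ^ k`, so they label the two halves of one part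
      -- of the previous level.
      have hj : j ≡ 2 ^ k + i [MOD 2 ^ (k + 1)] := by
        refine (Nat.ModEq.symm ?_)
        refine (Nat.modEq_iff_dvd' ?_).2 ⟨e, ?_⟩
        · have : 2 ^ k ≤ 2 ^ k * (2 * e + 1) := Nat.le_mul_of_pos_right _ (by omega)
          omega
        · have : 2 ^ k * (2 * e + 1) = 2 ^ (k + 1) * e + 2 ^ k := by ring
          omega
      rw [omegaSet_iterate_congr hj, hpow, Function.iterate_add_apply]
      exact separated_omegaSet_sq (hf.iterate _) (iterate_mem_Icc hr hm) (hT.iterate _)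
        (infinite_omegaSet_iterate hf hr hm hW i)
    · exact (ih hij').mono (hsub i) (hsub j)

end orbits

/-! ### Averages, densities and periodic majorants -/

section averages

theorem sum_range_periodic_le {p : ℕ → ℝ} {m : ℕ} {C : ℝ} (hm : 0 < m) (hp : ∀ n, 0 ≤ p n)
    (hper : ∀ n, p (n + m) = p n) (hC : ∑ i ∈ Finset.range m, p i ≤ C) (N : ℕ) :
    ∑ i ∈ Finset.range N, p i ≤ (N / m + 1) * C := by
  have hC0 : 0 ≤ C := (Finset.sum_nonneg fun i _ => hp i).trans hC
  have hmul : ∀ k n, p (n + m * k) = p n := by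
    intro k n
    induction k with
    | zero => simp
    | succ k ih => rw [Nat.mul_succ, ← add_assoc, hper, ih]
  have hsum : ∀ k : ℕ, ∑ i ∈ Finset.range (m * k), p i ≤ k * C := by
    intro k
    induction k with
    | zero => simp
    | succ k ih =>
      rw [Nat.mul_succ, Finset.sum_range_add]
      have : ∑ i ∈ Finset.range m, p (m * k + i) = ∑ i ∈ Finset.range m, p i :=
        Finset.sum_congr rfl fun i _ => by rw [add_comm, hmul]
      rw [this]
      push_cast
      linarith
  have hN : N ≤ m * (N / m + 1) := by
    have := Nat.div_add_mod N m
    have := Nat.mod_lt N hm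
    rw [Nat.mul_succ]
    omega
  have h1 : ∑ i ∈ Finset.range N, p i ≤ ∑ i ∈ Finset.range (m * (N / m + 1)), p i :=
    Finset.sum_le_sum_of_subset_of_nonneg (Finset.range_mono hN) fun i _ _ => hp i
  refine (h1.trans (hsum _)).trans ?_
  push_cast
  have : ((N / m : ℕ) : ℝ) ≤ (N : ℝ) / m := Nat.cast_div_le
  gcongr

/-- Averages of a sequence that is asymptotically dominated by a periodic sequence. -/
theorem limsup_average_le {u p e : ℕ → ℝ} {m : ℕ} {C : ℝ} (hm : 0 < m) (hu : ∀ n, 0 ≤ u n)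
    (hp : ∀ n, 0 ≤ p n) (hper : ∀ n, p (n + m) = p n) (hC : ∑ i ∈ Finset.range m, p i ≤ C)
    (he : Tendsto e atTop (𝓝 0)) (hle : ∀ n, u n ≤ p n + e n) :
    limsup (fun N : ℕ => (1 / (N : ℝ)) * ∑ n ∈ Finset.Icc 1 N, u n) atTop ≤ C / m := by
  have hmR : (0 : ℝ) < m := by exact_mod_cast hm
  have hshift : ∀ N, ∑ n ∈ Finset.Icc 1 N, e n = ∑ i ∈ Finset.range N, e (i + 1) := by
    intro N
    induction N with
    | zero => simp
    | succ N ih => rw [Finset.sum_Icc_succ_top (by omega), ih, Finset.sum_range_succ]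
  -- The `1 / N` term absorbs the incomplete last period and the extra index `0` added when `[1, N]`
  -- is enlarged to `range (N + 1)`.
  set v : ℕ → ℝ := fun N => C / m + (C / m + C) * (N : ℝ)⁻¹ +
    (N : ℝ)⁻¹ * ∑ i ∈ Finset.range N, e (i + 1) with hv
  have hvlim : Tendsto v atTop (𝓝 (C / m)) := by
    have h1 : Tendsto (fun N : ℕ => (C / m + C) * (N : ℝ)⁻¹) atTop (𝓝 ((C / m + C) * 0)) :=
      tendsto_inv_atTop_nhds_zero_nat.const_mul _
    have h2 := ((tendsto_add_atTop_iff_nat 1).2 he).cesaro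
    have := (h1.const_add (C / m)).add h2
    simpa using this
  rw [← hvlim.limsup_eq]
  refine limsup_le_limsup ?_ ?_ hvlim.isBoundedUnder_le
  · filter_upwards [eventually_gt_atTop 0] with N hN
    have hNR : (0 : ℝ) < N := by exact_mod_cast hN
    have h1 : ∑ n ∈ Finset.Icc 1 N, u n ≤ ∑ n ∈ Finset.Icc 1 N, p n + ∑ n ∈ Finset.Icc 1 N, e n := by
      rw [← Finset.sum_add_distrib]
      exact Finset.sum_le_sum fun n _ => hle n
    have h2 : ∑ n ∈ Finset.Icc 1 N, p n ≤ ∑ n ∈ Finset.range (N + 1), p n :=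
      Finset.sum_le_sum_of_subset_of_nonneg
        (fun n hn => by rw [Finset.mem_Icc] at hn; rw [Finset.mem_range]; omega) fun i _ _ => hp i
    have h3 := sum_range_periodic_le hm hp hper hC (N + 1)
    push_cast at h3
    rw [hshift] at h1
    calc (1 / (N : ℝ)) * ∑ n ∈ Finset.Icc 1 N, u n
        ≤ (1 / (N : ℝ)) * ((((N : ℝ) + 1) / m + 1) * C + ∑ i ∈ Finset.range N, e (i + 1)) := by
          gcongr; linarith
      _ = v N := by simp only [hv]; field_simp; ring
  · refine IsBoundedUnder.isCoboundedUnder_le (isBoundedUnder_of_eventually_ge (a := 0) ?_)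
    exact Eventually.of_forall fun N =>
      mul_nonneg (by positivity) (Finset.sum_nonneg fun n _ => hu n)

/-- Markov's inequality: the indicator of `ε ≤ p n` is at most `p n / ε`. -/
theorem upperDensity_le {p : ℕ → ℝ} {m : ℕ} {C ε : ℝ} (hm : 0 < m) (hε : 0 < ε)
    (hp : ∀ n, 0 ≤ p n) (hper : ∀ n, p (n + m) = p n) (hC : ∑ i ∈ Finset.range m, p i ≤ C) :
    upperDensity {n | ε ≤ p n} ≤ C / ε / m := by
  classical
  have hcard : ∀ N : ℕ, ((({n | ε ≤ p n} ∩ Set.Icc 1 N).ncard : ℝ) / (N : ℝ)) =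
      (1 / (N : ℝ)) * ∑ n ∈ Finset.Icc 1 N, if ε ≤ p n then (1 : ℝ) else 0 := by
    intro N
    have : ({n | ε ≤ p n} ∩ Set.Icc 1 N) =
        ((Finset.Icc 1 N).filter fun n => ε ≤ p n : Finset ℕ) := by
      ext n; simp [and_comm]
    rw [this, Set.ncard_coe_finset, Finset.sum_boole, one_div, inv_mul_eq_div]
  unfold upperDensity
  simp only [hcard]
  refine limsup_average_le (p := fun n => p n / ε) (e := fun _ => 0) hm ?_ ?_ ?_ ?_
    tendsto_const_nhds ?_
  · intro n; split_ifs <;> norm_num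
  · exact fun n => div_nonneg (hp n) hε.le
  · intro n; rw [hper]
  · rw [← Finset.sum_div]; gcongr
  · intro n
    rw [add_zero]
    split_ifs with h
    · rwa [one_le_div hε]
    · exact div_nonneg (hp n) hε.le

end averages

/-! ### Metric consequences of separation -/

section separated

/-- The convex hulls are disjoint intervals inside `[a, b]` and their lengths are the diameters, so
additivity of Lebesgue measure applies. -/
theorem sum_diam_le {a b : ℝ} (hab : a ≤ b) {m : ℕ} {S : ℕ → Set ℝ} (hS : ∀ i, IsCompact (S i))
    (hne : ∀ i, (S i).Nonempty) (hsub : ∀ i, S i ⊆ Icc a b)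
    (hsep : ∀ i < m, ∀ j < m, i ≠ j → Separated (S i) (S j)) :
    ∑ i ∈ Finset.range m, Metric.diam (S i) ≤ b - a := by
  have hI : ∀ i, sInf (S i) ∈ S i := fun i => (hS i).sInf_mem (hne i)
  have hU : ∀ i, sSup (S i) ∈ S i := fun i => (hS i).sSup_mem (hne i)
  have hdisj : (Finset.range m : Set ℕ).PairwiseDisjoint fun i => Icc (sInf (S i)) (sSup (S i)) := by
    intro i hi j hj hij
    refine disjoint_left.2 fun t ht ht' => ?_
    rcases hsep i (by simpa using hi) j (by simpa using hj) hij with h | h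
    · linarith [h _ (hU i) _ (hI j), ht.2, ht'.1]
    · linarith [h _ (hI i) _ (hU j), ht.1, ht'.2]
  have hvol := MeasureTheory.measure_biUnion_finset (μ := MeasureTheory.volume) hdisj
    fun i _ => measurableSet_Icc
  have hle : MeasureTheory.volume (⋃ i ∈ Finset.range m, Icc (sInf (S i)) (sSup (S i))) ≤
      MeasureTheory.volume (Icc a b) :=
    MeasureTheory.measure_mono (iUnion₂_subset fun i _ =>
      Icc_subset_Icc (hsub i (hI i)).1 (hsub i (hU i)).2)
  rw [hvol, Real.volume_Icc] at hle
  simp only [Real.volume_Icc] at hle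
  rw [← ENNReal.ofReal_sum_of_nonneg, ENNReal.ofReal_le_ofReal_iff (by linarith)] at hle
  · calc _ = ∑ i ∈ Finset.range m, (sSup (S i) - sInf (S i)) :=
          Finset.sum_congr rfl fun i _ => Real.diam_eq (hS i).isBounded
      _ ≤ _ := hle
  · intro i _
    rw [← Real.diam_eq (hS i).isBounded]
    exact Metric.diam_nonneg

theorem exists_pos_le_dist {m : ℕ} {S : ℕ → Set ℝ} (hS : ∀ i, IsCompact (S i))
    (hsep : ∀ i < m, ∀ j < m, i ≠ j → Separated (S i) (S j)) :
    ∃ δ > 0, ∀ i < m, ∀ j < m, i ≠ j → ∀ u ∈ S i, ∀ v ∈ S j, δ ≤ dist u v := by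
  set P : Set (ℕ × ℕ) := {q | q.1 < m ∧ q.2 < m ∧ q.1 ≠ q.2}
  have hP : P.Finite := ((finite_Iio m).prod (finite_Iio m)).subset fun q hq => ⟨hq.1, hq.2.1⟩
  have hA : IsCompact (⋃ q ∈ P, S q.1 ×ˢ S q.2) :=
    hP.isCompact_biUnion fun q _ => (hS q.1).prod (hS q.2)
  have hmem : ∀ i < m, ∀ j < m, i ≠ j → ∀ u ∈ S i, ∀ v ∈ S j,
      (u, v) ∈ ⋃ q ∈ P, S q.1 ×ˢ S q.2 := fun i hi j hj hij u hu v hv =>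
    mem_biUnion (x := (i, j)) (show (i, j) ∈ P from ⟨hi, hj, hij⟩) ⟨hu, hv⟩
  rcases (⋃ q ∈ P, S q.1 ×ˢ S q.2).eq_empty_or_nonempty with he | hne
  · refine ⟨1, one_pos, fun i hi j hj hij u hu v hv => ?_⟩
    have := hmem i hi j hj hij u hu v hv
    rw [he] at this
    exact absurd this (notMem_empty _)
  · obtain ⟨⟨u0, v0⟩, h0, hmin⟩ := hA.exists_isMinOn hne continuous_dist.continuousOn
    refine ⟨dist u0 v0, ?_, fun i hi j hj hij u hu v hv => hmin (hmem i hi j hj hij u hu v hv)⟩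
    obtain ⟨q, hq, hq'⟩ := mem_iUnion₂.1 h0
    refine dist_pos.2 ?_
    rcases hsep _ hq.1 _ hq.2.1 hq.2.2 with h | h
    · exact (h _ hq'.1 _ hq'.2).ne
    · exact (h _ hq'.1 _ hq'.2).ne'

theorem exists_pos_eq_of_dist_lt {X : Type*} [MetricSpace X] {S : Set X} (hS : S.Finite) :
    ∃ δ > 0, ∀ u ∈ S, ∀ v ∈ S, dist u v < δ → u = v := by
  rcases S.subsingleton_or_nontrivial with h | h
  · exact ⟨1, one_pos, fun u hu v hv _ => h hu hv⟩
  · refine ⟨S.infsep, hS.infsep_pos_iff_nontrivial.2 h, fun u hu v hv huv => ?_⟩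
    by_contra hne
    exact absurd (Set.infsep_le_dist_of_mem hu hv hne) (not_le.2 huv)

end separated

/-! ### Orbits following the parts of their limit sets -/

section cycles

variable {f : ℝ → ℝ} {x a b : ℝ}

theorem eventually_of_residues {P : ℕ → Prop} {m : ℕ} (hm : 0 < m)
    (h : ∀ i < m, ∀ᶠ k in atTop, P (m * k + i)) : ∀ᶠ n in atTop, P n := by
  have h' : ∀ᶠ k in atTop, ∀ i ∈ Finset.range m, P (m * k + i) := by
    rw [Filter.eventually_all_finset]
    exact fun i hi => h i (Finset.mem_range.1 hi)
  filter_upwards [(Nat.tendsto_div_const_atTop hm.ne').eventually h'] with n hn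
  have := hn (n % m) (Finset.mem_range.2 (Nat.mod_lt _ hm))
  rwa [Nat.div_add_mod] at this

theorem tendsto_infDist_omegaSet_iterate (hr : ∀ t, f t ∈ Icc a b) {m : ℕ} (hm : 0 < m) :
    Tendsto (fun n => Metric.infDist (f^[n] x) (omegaSet f^[m] (f^[n] x))) atTop (𝓝 0) := by
  have hr' : ∀ t, f^[m] t ∈ Icc a b := iterate_mem_Icc hr hm
  rw [Metric.tendsto_nhds]
  intro η hη
  refine eventually_of_residues hm fun i _ => ?_
  have := eventually_mem_of_omegaSet_subset (x := f^[i] x) hr' Metric.isOpen_thickening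
    (Metric.self_subset_thickening hη (omegaSet f^[m] (f^[i] x)))
  filter_upwards [this] with k hk
  rw [iterate_mul_add, Metric.mem_thickening_iff_infDist_lt (omegaSet_nonempty hr')] at hk
  rw [Real.dist_0_eq_abs, abs_of_nonneg Metric.infDist_nonneg]
  rwa [omegaSet_iterate_congr (i := m * k + i) (j := i)
    (Nat.modEq_iff_dvd.2 ⟨-k, by push_cast; ring⟩)]

theorem diam_omegaSet_periodic {m : ℕ} (n : ℕ) :
    Metric.diam (omegaSet f^[m] (f^[n + m] x)) = Metric.diam (omegaSet f^[m] (f^[n] x)) := by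
  rw [omegaSet_iterate_congr (i := n + m) (j := n) (Nat.modEq_iff_dvd.2 ⟨-1, by push_cast; ring⟩)]

theorem separated_of_lt (hf : Continuous f) (hr : ∀ t, f t ∈ Icc a b) (hT : Tame f)
    (hW : (omegaSet f x).Infinite) (k : ℕ) : ∀ i < 2 ^ k, ∀ j < 2 ^ k, i ≠ j →
      Separated (omegaSet f^[2 ^ k] (f^[i] x)) (omegaSet f^[2 ^ k] (f^[j] x)) :=
  fun _ hi _ hj hij => separated_omegaSet_two_pow hf hr hT hW k fun h =>
    hij (Nat.ModEq.eq_of_lt_of_lt h hi hj)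

theorem sum_diam_omegaSet_le (hr : ∀ t, f t ∈ Icc a b) {m : ℕ} (hm : 0 < m)
    (hsep : ∀ i < m, ∀ j < m, i ≠ j →
      Separated (omegaSet f^[m] (f^[i] x)) (omegaSet f^[m] (f^[j] x))) :
    ∑ i ∈ Finset.range m, Metric.diam (omegaSet f^[m] (f^[i] x)) ≤ b - a := by
  have hr' : ∀ t, f^[m] t ∈ Icc a b := iterate_mem_Icc hr hm
  exact sum_diam_le ((hr 0).1.trans (hr 0).2) (fun i => isCompact_omegaSet hr')
    (fun i => omegaSet_nonempty hr') (fun i => omegaSet_subset_Icc hr') hsep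

/-- Infinite `ω`-limit sets of tame maps are cycles of arbitrarily many separated parts. -/
theorem exists_separated_cycle (hf : Continuous f) (hr : ∀ t, f t ∈ Icc a b) (hT : Tame f) (C : ℝ)
    {ε : ℝ} (hε : 0 < ε) : ∃ m : ℕ, 0 < m ∧ C / m < ε ∧ ∀ x, (omegaSet f x).Infinite →
      ∀ i < m, ∀ j < m, i ≠ j →
        Separated (omegaSet f^[m] (f^[i] x)) (omegaSet f^[m] (f^[j] x)) := by
  have : Tendsto (fun k : ℕ => C / ((2 ^ k : ℕ) : ℝ)) atTop (𝓝 0) := by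
    push_cast
    exact tendsto_const_nhds.div_atTop (tendsto_pow_atTop_atTop_of_one_lt one_lt_two)
  obtain ⟨k, hk⟩ := (this.eventually (gt_mem_nhds hε)).exists
  exact ⟨2 ^ k, by positivity, hk, fun x hW => separated_of_lt hf hr hT hW k⟩

/-- A point of the part `0` of an infinite `ω`-limit set shadows the orbit in the mean. -/
theorem limsup_average_dist_le (hf : Continuous f) (hr : ∀ t, f t ∈ Icc a b) {m : ℕ} (hm : 0 < m)
    (hsep : ∀ i < m, ∀ j < m, i ≠ j →
      Separated (omegaSet f^[m] (f^[i] x)) (omegaSet f^[m] (f^[j] x)))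
    {z : ℝ} (hz : z ∈ omegaSet f^[m] x) :
    limsup (fun N : ℕ => (1 / (N : ℝ)) * ∑ n ∈ Finset.Icc 1 N, dist (f^[n] x) (f^[n] z)) atTop
      ≤ (b - a) / m := by
  have hr' : ∀ t, f^[m] t ∈ Icc a b := iterate_mem_Icc hr hm
  refine limsup_average_le (p := fun n => Metric.diam (omegaSet f^[m] (f^[n] x))) hm
    (fun n => dist_nonneg) (fun n => Metric.diam_nonneg) diam_omegaSet_periodic
    (sum_diam_omegaSet_le hr hm hsep) (tendsto_infDist_omegaSet_iterate (x := x) hr hm) fun n => ?_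
  obtain ⟨s, hs, hsd⟩ := (isCompact_omegaSet (x := f^[n] x) hr').exists_infDist_eq_dist
    (omegaSet_nonempty hr') (f^[n] x)
  have := Metric.dist_le_diam_of_mem (isCompact_omegaSet (x := f^[n] x) hr').isBounded hs
    (map_mem_omegaSet_iterate hf n hz)
  rw [hsd]
  linarith [dist_triangle (f^[n] x) s (f^[n] z)]

/-- An orbit with finite `ω`-limit set shadows the points of that set. -/
theorem exists_shadow_of_finite (hf : Continuous f) (hr : ∀ t, f t ∈ Icc a b)
    (hW : (omegaSet f x).Finite) {w : ℝ} (hw : w ∈ omegaSet f x) {η : ℝ} (hη : 0 < η) :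
    ∃ n, ∀ j, dist (f^[j + n] x) (f^[j] w) < η := by
  obtain ⟨δ, hδ, hδW⟩ := exists_pos_eq_of_dist_lt hW
  have hθ : 0 < min η (δ / 2) := by positivity
  set θ := min η (δ / 2)
  -- Capping `ρ` by `1` keeps `t` in `[a - 1, b + 1]`, where `f` is uniformly continuous.
  obtain ⟨ρ, hρ, hρθ, hρf⟩ : ∃ ρ > 0, ρ ≤ θ ∧ ∀ w ∈ omegaSet f x, ∀ t, dist t w < ρ →
      dist (f t) (f w) < θ := by
    obtain ⟨ρ, hρ, h⟩ := Metric.uniformContinuousOn_iff.1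
      ((isCompact_Icc (a := a - 1) (b := b + 1)).uniformContinuousOn_of_continuous
        hf.continuousOn) θ hθ
    refine ⟨min (min ρ θ) 1, by positivity, (min_le_left _ _).trans (min_le_right _ _),
      fun w hw t ht => ?_⟩
    have hwI := omegaSet_subset_Icc hr hw
    have ht1 : dist t w < 1 := ht.trans_le (min_le_right _ _)
    have ht2 : dist t w < ρ := ht.trans_le ((min_le_left _ _).trans (min_le_left _ _))
    rw [Real.dist_eq, abs_lt] at ht1
    exact h t ⟨by linarith [hwI.1], by linarith [hwI.2]⟩ w
      ⟨by linarith [hwI.1], by linarith [hwI.2]⟩ ht2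
  obtain ⟨N, hN⟩ := eventually_atTop.1 (eventually_mem_of_omegaSet_subset (x := x) hr
    Metric.isOpen_thickening (Metric.self_subset_thickening hρ (omegaSet f x)))
  obtain ⟨n, hn, hnw⟩ := exists_ge_of_mem_omegaSet hw (Metric.ball_mem_nhds w hρ) N
  refine ⟨n, fun j => lt_of_lt_of_le ?_ (hρθ.trans (min_le_left _ _))⟩
  induction j with
  | zero => simpa using hnw
  | succ j ih =>
    have hwj := map_mem_omegaSet hf j hw
    have h1 := hρf _ hwj _ ih
    rw [← Function.iterate_succ_apply' f, ← Function.iterate_succ_apply' f] at h1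
    obtain ⟨w', hw', hw'd⟩ := Metric.mem_thickening_iff.1 (hN (j + n + 1) (by omega))
    have hθδ : θ ≤ δ / 2 := min_le_right _ _
    -- The next orbit point is within `δ / 2` both of `f^[j + 1] w` and of some point of the limit
    -- set. By the choice of `δ` these coincide, which restores the sharper bound `ρ`.
    have heq : w' = f^[j + 1] w := hδW w' hw' _ (map_mem_omegaSet hf (j + 1) hw) (by
      have := dist_triangle_left w' (f^[j + 1] w) (f^[j + n + 1] x)
      linarith)
    rw [show j + 1 + n = j + n + 1 by omega, ← heq]
    exact hw'd

end cycles

/-! ### Minimal sets -/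

section minimal

variable {X : Type*} [MetricSpace X] {f : X → X}

theorem exists_isMinimalSet [CompactSpace X] (hf : Continuous f) {S : Set X} (hS : IsClosed S)
    (hne : S.Nonempty) (hinv : MapsTo f S S) : ∃ K ⊆ S, IsMinimalSet f K := by
  obtain ⟨K, hKS, hK⟩ := zorn_superset_nonempty
    {A : Set X | IsClosed A ∧ A.Nonempty ∧ MapsTo f A A} (fun c hc hchain hcne => by
      refine ⟨⋂₀ c, ⟨isClosed_sInter fun A hA => (hc hA).1, ?_, ?_⟩, fun s hs => sInter_subset_of_mem hs⟩
      · have : Nonempty c := hcne.to_subtype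
        refine IsCompact.nonempty_sInter_of_directed_nonempty_isCompact_isClosed ?_
          (fun A hA => (hc hA).2.1) (fun A hA => (hc hA).1.isCompact) (fun A hA => (hc hA).1)
        intro A hA B hB
        rcases hchain.total hA hB with h | h
        · exact ⟨A, hA, subset_rfl, h⟩
        · exact ⟨B, hB, h, subset_rfl⟩
      · exact fun y hy A hA => (hc hA).2.2 (hy A hA)) S ⟨hS, hne, hinv⟩
  refine ⟨K, hKS, hK.prop.1, hK.prop.2.1, hK.prop.2.2, fun y hy => ?_⟩
  have hmem : ∀ n, f^[n] y ∈ K := fun n => hK.prop.2.2.iterate n hy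
  have hsub : closure {z : X | ∃ n : ℕ, 1 ≤ n ∧ f^[n] y = z} ⊆ K :=
    closure_minimal (by rintro _ ⟨n, -, rfl⟩; exact hmem n) hK.prop.1
  refine subset_antisymm hsub (hK.le_of_le ⟨isClosed_closure, ?_, ?_⟩ hsub)
  · exact ⟨f y, subset_closure ⟨1, le_rfl, rfl⟩⟩
  · refine MapsTo.closure ?_ hf
    rintro _ ⟨n, hn, rfl⟩
    exact ⟨n + 1, by omega, Function.iterate_succ_apply' f n y⟩

/-- The compact set `f '' K` contains the forward orbit of `z`, which is dense in `K`; hence `f`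
maps `K` onto itself. This permits synchronising a shadowed point with an orbit at any given time.
-/
theorem IsMinimalSet.exists_preimage_iterate [CompactSpace X] (hf : Continuous f) {K : Set X}
    (hK : IsMinimalSet f K) (n : ℕ) {z : X} (hz : z ∈ K) : ∃ y ∈ K, f^[n] y = z := by
  induction n generalizing z with
  | zero => exact ⟨z, hz, rfl⟩
  | succ n ih =>
    have hsub : closure {w : X | ∃ n : ℕ, 1 ≤ n ∧ f^[n] z = w} ⊆ f '' K := by
      refine closure_minimal ?_ (hK.isClosed.isCompact.image hf).isClosed
      rintro _ ⟨n, hn, rfl⟩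
      obtain ⟨k, rfl⟩ : ∃ k, n = k + 1 := ⟨n - 1, by omega⟩
      exact ⟨f^[k] z, hK.mapsTo.iterate k hz, (Function.iterate_succ_apply' f k z).symm⟩
    rw [hK.closure_orbit z hz] at hsub
    obtain ⟨y, hy, hyz⟩ := hsub hz
    obtain ⟨y', hy', hyy⟩ := ih hy
    exact ⟨y', hy', by rw [Function.iterate_succ_apply', hyy, hyz]⟩

end minimal

/-! ### The two conclusions on the interval -/

section interval

variable {a b : ℝ} (hab : a ≤ b) {f : Icc a b → Icc a b}

theorem meanAttracted_of_subset_omegaSet (hf : Continuous f)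
    (hT : Tame (IccExtend hab fun t => (f t : ℝ))) (x : Icc a b) {K : Set (Icc a b)}
    (hK : IsMinimalSet f K)
    (hKW : K ⊆ Subtype.val ⁻¹' omegaSet (IccExtend hab fun t => (f t : ℝ)) x) :
    MeanAttracted f K x := by
  intro ε hε
  set F := IccExtend hab fun t => (f t : ℝ) with hF
  have hFc : Continuous F := (continuous_subtype_val.comp hf).Icc_extend'
  have hFr : ∀ t, F t ∈ Icc a b := fun t => (f _).2
  have hit : ∀ n (y : Icc a b), F^[n] y = f^[n] y := IccExtend_iterate hab f
  obtain ⟨w, hw⟩ := hK.nonempty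
  have hwW : (w : ℝ) ∈ omegaSet F x := hKW hw
  simp only [Subtype.dist_eq, ← hit]
  by_cases hW : (omegaSet F x).Finite
  · obtain ⟨n, hn⟩ := exists_shadow_of_finite hFc hFr hW hwW (half_pos hε)
    obtain ⟨z, hz, hzw⟩ := hK.exists_preimage_iterate hf n hw
    -- From time `n` on, the orbit of `z` is that of `w` and stays within `ε / 2` of the orbit of
    -- `x`. The error `e` absorbs the earlier times.
    refine ⟨z, hz, lt_of_le_of_lt (limsup_average_le (m := 1) (C := ε / 2) (p := fun _ => ε / 2)
      (e := fun n => max (dist (F^[n] x) (F^[n] z) - ε / 2) 0) one_pos (fun n => dist_nonneg)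
      (fun _ => by positivity) (fun _ => rfl) (by simp) ?_ fun n => ?_) (by simpa using hε)⟩
    · refine tendsto_const_nhds.congr' ?_
      filter_upwards [eventually_ge_atTop n] with k hk
      have h1 := hn (k - n)
      have h2 : F^[k - n] w = F^[k] z := by
        rw [hit, hit, ← hzw, ← Function.iterate_add_apply, Nat.sub_add_cancel hk]
      rw [Nat.sub_add_cancel hk, h2] at h1
      exact (max_eq_right (by linarith)).symm
    · linarith [le_max_left (dist (F^[n] x) (F^[n] z) - ε / 2) 0]
  · obtain ⟨m, hm, hmε, hsep⟩ := exists_separated_cycle hFc hFr hT (b - a) hε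
    obtain ⟨i, hi, hiw⟩ := exists_mem_omegaSet_iterate hm hwW
    -- Moving `w` on by `m - i` steps brings it from part `i` round to part `0`, the one in phase
    -- with `x`.
    have h1 := map_mem_omegaSet_iterate hFc (m - i) hiw
    rw [← Function.iterate_add_apply, Nat.sub_add_cancel hi.le,
      omegaSet_iterate_congr (i := m) (j := 0) (by simp [Nat.ModEq]),
      hit (m - i) w] at h1
    exact ⟨f^[m - i] w, hK.mapsTo.iterate _ hw,
      (limsup_average_dist_le hFc hFr hm (hsep _ hW) h1).trans_lt hmε⟩

theorem minimallyMeanAttractable_of_tame (hf : Continuous f)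
    (hT : Tame (IccExtend hab fun t => (f t : ℝ))) : MinimallyMeanAttractable f := by
  refine (eq_univ_of_forall fun x => ?_).symm
  set F := IccExtend hab fun t => (f t : ℝ) with hF
  have hFc : Continuous F := (continuous_subtype_val.comp hf).Icc_extend'
  have hFr : ∀ t, F t ∈ Icc a b := fun t => (f _).2
  obtain ⟨K, hKW, hK⟩ := exists_isMinimalSet hf (S := Subtype.val ⁻¹' omegaSet F x)
    (isClosed_omegaSet.preimage continuous_subtype_val)
    (by
      obtain ⟨y, hy⟩ := omegaSet_nonempty (f := F) (x := x) hFr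
      exact ⟨⟨y, omegaSet_subset_Icc hFr hy⟩, hy⟩)
    (fun y hy => by
      have := map_mem_omegaSet hFc 1 hy
      rwa [IccExtend_iterate] at this)
  exact mem_iUnion₂.2 ⟨K, hK, meanAttracted_of_subset_omegaSet hab hf hT x hK hKW⟩

/-- The limit set lies in the closed invariant `K`; conversely it is closed and contains the orbit
of any of its points, which is dense in `K`. -/
theorem IsMinimalSet.image_eq_omegaSet {K : Set (Icc a b)} (hK : IsMinimalSet f K)
    (hf : Continuous f) {x : Icc a b} (hx : x ∈ K) :
    Subtype.val '' K = omegaSet (IccExtend hab fun t => (f t : ℝ)) x := by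
  set F := IccExtend hab fun t => (f t : ℝ) with hF
  have hFc : Continuous F := (continuous_subtype_val.comp hf).Icc_extend'
  have hFr : ∀ t, F t ∈ Icc a b := fun t => (f _).2
  have hit : ∀ n (y : Icc a b), F^[n] y = f^[n] y := IccExtend_iterate hab f
  have hsub : omegaSet F x ⊆ Subtype.val '' K := omegaSet_subset
    (hK.isClosed.isCompact.image continuous_subtype_val).isClosed
    (Eventually.of_forall fun n => ⟨f^[n] x, hK.mapsTo.iterate n hx, (hit n x).symm⟩)
  refine subset_antisymm ?_ hsub
  obtain ⟨w, hw⟩ := omegaSet_nonempty (f := F) (x := x) hFr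
  obtain ⟨k, hk, rfl⟩ := hsub hw
  rw [image_subset_iff, ← hK.closure_orbit k hk]
  refine closure_minimal ?_ (isClosed_omegaSet.preimage continuous_subtype_val)
  rintro _ ⟨n, -, rfl⟩
  rw [mem_preimage, ← hit]
  exact map_mem_omegaSet hFc n hw

theorem minimallyMeanLStable_of_tame (hf : Continuous f)
    (hT : Tame (IccExtend hab fun t => (f t : ℝ))) : MinimallyMeanLStable f := by
  intro K hK ε hε
  set F := IccExtend hab fun t => (f t : ℝ) with hF
  have hFc : Continuous F := (continuous_subtype_val.comp hf).Icc_extend'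
  have hFr : ∀ t, F t ∈ Icc a b := fun t => (f _).2
  have hit : ∀ n (y : Icc a b), F^[n] y = f^[n] y := IccExtend_iterate hab f
  obtain ⟨x₀, hx₀⟩ := hK.nonempty
  have hKW := hK.image_eq_omegaSet hab hf hx₀
  simp only [hK.mapsTo.iterate_restrict]
  simp only [Subtype.dist_eq, MapsTo.val_restrict_apply, ← hit]
  by_cases hW : (omegaSet F x₀).Finite
  · obtain ⟨δ, hδ, h⟩ := exists_pos_eq_of_dist_lt hW
    refine ⟨δ, hδ, fun x y hxy => ⟨∅, by simpa [upperDensity] using hε, fun n _ _ => ?_⟩⟩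
    have : (x : Icc a b).val = (y : Icc a b).val :=
      h _ (hKW ▸ mem_image_of_mem _ x.2) _ (hKW ▸ mem_image_of_mem _ y.2) hxy
    rw [this, dist_self]
    exact hε
  · obtain ⟨m, hm, hmε, hsep⟩ := exists_separated_cycle hFc hFr hT ((b - a) / ε) hε
    have hr' : ∀ t, F^[m] t ∈ Icc a b := iterate_mem_Icc hFr hm
    obtain ⟨δ, hδ, h⟩ := exists_pos_le_dist (S := fun i => omegaSet F^[m] (F^[i] x₀))
      (fun i => isCompact_omegaSet hr') (hsep _ hW)
    refine ⟨δ, hδ, fun x y hxy => ?_⟩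
    obtain ⟨i, hi, hxi⟩ := exists_mem_omegaSet_iterate hm
      (show ((x : Icc a b) : ℝ) ∈ omegaSet F x₀ from hKW ▸ mem_image_of_mem _ x.2)
    obtain ⟨j, hj, hyj⟩ := exists_mem_omegaSet_iterate hm
      (show ((y : Icc a b) : ℝ) ∈ omegaSet F x₀ from hKW ▸ mem_image_of_mem _ y.2)
    have hij : i = j := by
      by_contra hne
      exact absurd (h i hi j hj hne _ hxi _ hyj) (not_le.2 hxy)
    subst hij
    have hW' : (omegaSet F (F^[i] x₀)).Infinite := by rwa [omegaSet_iterate_apply]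
    refine ⟨{n | ε ≤ Metric.diam (omegaSet F^[m] (F^[n] (F^[i] x₀)))},
      (upperDensity_le (p := fun n => Metric.diam (omegaSet F^[m] (F^[n] (F^[i] x₀)))) hm hε
        (fun n => Metric.diam_nonneg) (fun n => diam_omegaSet_periodic n)
        (sum_diam_omegaSet_le hFr hm (hsep _ hW'))).trans_lt hmε, fun n _ hn => ?_⟩
    exact (Metric.dist_le_diam_of_mem (isCompact_omegaSet hr').isBounded
      (map_mem_omegaSet_iterate hFc n hxi) (map_mem_omegaSet_iterate hFc n hyj)).trans_lt
        (not_le.1 hn)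

end interval

end MeanDynamics

theorem theorem1p1 (a b : ℝ) (hab : a ≤ b) (f : Set.Icc a b → Set.Icc a b) (hf : Continuous f)
    (hent : Dynamics.coverEntropy f Set.univ = 0) :
    MeanDynamics.MinimallyMeanAttractable f ∧ MeanDynamics.MinimallyMeanLStable f :=
  have hT := MeanDynamics.tame_IccExtend hab hf hent
  ⟨MeanDynamics.minimallyMeanAttractable_of_tame hab hf hT,
    MeanDynamics.minimallyMeanLStable_of_tame hab hf hT⟩
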